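/- Conventions. For $b>0$, $\mathrm{Laplace}(0,b)$ is the law on $\mathbb{R}$ with density $w\mapsto\frac{1}{2b}e^{-|w|/b}$. For Borel probability measures $\rho_1,\rho_2$ on $\mathbb{R}$, $$d_{BL}(\rho_1,\rho_2)=\sup_h\Big|\int h\,d\rho_1-\int h\,d\rho_2\Big|,$$ where $h$ ranges over the functions $h:\mathbb{R}\to\mathbb{R}$ with $\|h\|_\infty\le 1$ and $|h(x)-h(y)|\le|x-y|$ for all $x,y$. For a random variable $X$ with $E[X^2]<\infty$, a random variable $X^L$ has the symmetric equilibrium distribution with respect to $X$ if $$E[f(X)]-f(0)=\tfrac12E[X^2]\,E[f''(X^L)]$$ for all $f:\mathbb{R}\to\mathbb{R}$ such that $f$ and $f'$ are absolutely continuous (on compact intervals) and $f(X)$, $f'(X)$, $f''(X^L)$ are integrable. Theorem 6. Let $N$ be a random variable with values in the non-negative integers and $0<\mu:=E[N]<\infty$. Let $X_1,X_2,\dots$ be independent random variables with $P(X_i<0)=P(X_i>0)=\frac12$, $E[X_i]=0$ and $E[X_i^2]=\sigma_i^2<\infty$, where $\sigma_i\ge0$. Put $\sigma=\big(E\big[\sum_{i=1}^N\sigma_i^2\big]\big)^{1/2}$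 and assume $\sigma<\infty$. Let $M$ be an integer-valued random variable, defined on the same space as $N$, with $$P(M=m)=\frac{\sigma_m^2}{\sigma^2}\,P(N\ge m),\qquad m=1,2,\dots,$$ and suppose that the pair $(N,M)$ is independent of the sequence $(X_i)_{i\ge1}$. Then: (i) $E\big[\big(\sum_{i=1}^NX_i\big)^2\big]=\sigma^2$. (ii) For each $i\ge1$ there is a symmetric equilibrium distribution with respect to $X_i$. (iii) Let $X_1^L,X_2^L,\dots$ be any random variables on the same probability space such that $X_i^L$ has the symmetric equilibrium distribution with respect to $X_i$ and is independent of $(X_1,\dots,X_{i-1})$ for each $i\ge1$, and such that $(N,M)$ is independent of $\big((X_i,X_i^L)\big)_{i\ge1}$. Then $$d_{BL}\Big(\mathscr{L}\Big(\mu^{-1/2}\sum_{i=1}^NX_i\Big),\ \mathrm{Laplace}\Big(0,\frac{\sigma}{\sqrt{2\mu}}\Big)\Big)\le\Big(\mu^{-1/2}+\frac{\sqrt8}{\sigma}\Big)E\Big|(X_M-X_M^L)+\mathrm{sgn}(N-M)\sum_{i=(N\wedge M)+1}^{N\vee M}X_i\Big|,$$ and the right-hand side is at most $$\Big(\mu^{-1/2}+\frac{\sqrt8}{\sigma}\Big)\Big(E|X_M|+\frac13E\Big[\frac{|X_M|^3}{\sigma_M^2}\Big]+\sup_{i\ge1}\sigma_i\cdot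 E\big[|N-M|^{1/2}\big]\Big).$$ (iv) The left-hand side of the first inequality in (iii) is at most the last expression in (iii) whether or not such variables $X_i^L$ exist on the given probability space. The bounds may be infinite, with $\infty\cdot0=0$. -/

import Mathlib

open MeasureTheory ProbabilityTheory
open scoped ENNReal

noncomputable section

/-- The Laplace distribution with location `a` and scale `b > 0`, through its density
`w ↦ (2b)⁻¹ exp (-|w - a| / b)`. -/
def laplaceMeasure (a b : ℝ) : Measure ℝ :=
  volume.withDensity fun w => ENNReal.ofReal (1 / (2 * b) * Real.exp (-|w - a| / b))

/-- The class of test functions bounded by `1` that are `1`-Lipschitz. -/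
def boundedLipschitzClass : Set (ℝ → ℝ) :=
  {h | (∀ x, |h x| ≤ 1) ∧ ∀ x y, |h x - h y| ≤ |x - y|}

/-- The bounded Lipschitz distance between two Borel probability measures on `ℝ`. -/
def dBL (ρ₁ ρ₂ : Measure ℝ) : ℝ≥0∞ :=
  ⨆ h ∈ boundedLipschitzClass, ENNReal.ofReal |(∫ x, h x ∂ρ₁) - ∫ x, h x ∂ρ₂|

/-- Absolute continuity of a function on the real line: absolute continuity on every compact
interval. -/
def IsAbsCont (f : ℝ → ℝ) : Prop :=
  ∀ a b : ℝ, AbsolutelyContinuousOnInterval f a b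

/-- `ρL` is the symmetric equilibrium distribution with respect to `ρ` (the law of `X`, with
`E[X ^ 2] < ∞`): `ρL` is the law of a random variable `XL` such that
`E[f(X)] - f(0) = E[X ^ 2] / 2 * E[f''(XL)]` for all `f` such that `f` and `f'` are absolutely
continuous and the expectations of `f(X)`, `f'(X)` and `f''(XL)` exist.
(If `f` and `deriv f` are absolutely continuous, then `f` is continuously differentiable, and
`deriv (deriv f)` is the almost everywhere defined second derivative.) -/
structure IsSymmetricEquilibrium (ρ ρL : Measure ℝ) : Prop where
  isProbabilityMeasure : IsProbabilityMeasure ρL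
  integrable_sq : Integrable (fun x : ℝ => x ^ 2) ρ
  integral_eq : ∀ f : ℝ → ℝ, IsAbsCont f → IsAbsCont (deriv f) →
    Integrable f ρ → Integrable (deriv f) ρ → Integrable (deriv (deriv f)) ρL →
    (∫ x, f x ∂ρ) - f 0 = 1 / 2 * (∫ x, x ^ 2 ∂ρ) * ∫ x, deriv (deriv f) x ∂ρL

end

/-! Stein's method. Put c = μ^(-1/2), b = σ/√(2μ) and S_n = X_1 + ⋯ + X_n. For a test function h let
g(x) = E h(x + L) with L ~ Laplace(0, b). Then g - b²g'' = h and g(0) = E h(L), so with F(x) =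
b²g''(cx) the error E h(cS_N) - E h(L) equals E g(cS_N) - g(0) - E F(S_N)
(`exists_laplace_stein_solution`).

The equilibrium identity, applied to x ↦ g(c(a + x)) with a = S_(m-1) frozen, evaluates the
increment of E g(cS_m) as (σ_m²/2) c² E g''(c(S_(m-1) + X_m^L)), where X_m^L is independent of
S_(m-1). Summing up to N weighs index m by σ_m² P(N ≥ m) = σ² P(M = m), so the sum collapses to one
expectation at the random index M (`integral_comp_partialSum_card`). Since σ²c²/2 = b², the error
becomes E F(S_(M-1) + X_M^L) - E F(S_N) (`exists_stein_representation`), and the Lipschitz constant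
of F gives the first bound.

For the second bound, the equilibrium law is explicit: it is the law of VY with Y square-biased and
V of density 2(1 - v) on [0, 1], by Taylor's formula with integral remainder. It is unique when the
variance is positive, hence E|X^L| = E|X|³/(3σ²) for every version of X^L. The sum between N and M
is handled by Cauchy–Schwarz given (N, M). Only the laws of the X_m^L enter the representation, so
the final bound also follows by integrating against those laws, without realizing the variables. -/

/-! ### The Stein equation of the Laplace distribution -/

theorem continuous_of_mem_boundedLipschitzClass {h : ℝ → ℝ} (hh : h ∈ boundedLipschitzClass) :
    Continuous h := by
  have : LipschitzWith 1 h := LipschitzWith.of_dist_le_mul fun x y => by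
    simpa [Real.dist_eq] using hh.2 x y
  exact this.continuous

theorem integrableOn_exp_mul_Iic_of_bounded {a : ℝ} (ha : 0 < a) {h : ℝ → ℝ} (hc : Continuous h)
    (hb : ∀ x, |h x| ≤ 1) (x : ℝ) :
    IntegrableOn (fun y => Real.exp (a * y) * h y) (Set.Iic x) := by
  refine (integrableOn_exp_mul_Iic ha x).mono' (by fun_prop) (ae_of_all _ fun y => ?_)
  rw [norm_mul, Real.norm_eq_abs, Real.norm_eq_abs, abs_of_pos (Real.exp_pos _)]
  exact mul_le_of_le_one_right (Real.exp_pos _).le (hb y)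

/-- The left half of the resolvent kernel of the Laplace distribution, applied to `h`. -/
noncomputable def expIicIntegral (a : ℝ) (h : ℝ → ℝ) (x : ℝ) : ℝ :=
  ∫ y in Set.Iic x, Real.exp (a * y) * h y

theorem hasDerivAt_expIicIntegral {a : ℝ} (ha : 0 < a) {h : ℝ → ℝ} (hc : Continuous h)
    (hb : ∀ x, |h x| ≤ 1) (x : ℝ) :
    HasDerivAt (expIicIntegral a h) (Real.exp (a * x) * h x) x := by
  have hi := integrableOn_exp_mul_Iic_of_bounded ha hc hb
  have e : expIicIntegral a h =
      fun x => expIicIntegral a h 0 + ∫ y in (0 : ℝ)..x, Real.exp (a * y) * h y := by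
    funext x
    have := intervalIntegral.integral_Iic_sub_Iic (hi 0) (hi x)
    rw [← this]
    simp [expIicIntegral]
  rw [e]
  refine HasDerivAt.const_add _ ?_
  have hcont : Continuous fun y => Real.exp (a * y) * h y := by fun_prop
  exact hcont.integral_hasStrictDerivAt 0 x |>.hasDerivAt

theorem abs_expIicIntegral_le {a : ℝ} (ha : 0 < a) {h : ℝ → ℝ}
    (hb : ∀ x, |h x| ≤ 1) (x : ℝ) :
    |expIicIntegral a h x| ≤ Real.exp (a * x) / a := by
  rw [← integral_exp_mul_Iic ha x]
  rw [expIicIntegral, ← Real.norm_eq_abs]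
  refine norm_integral_le_of_norm_le (integrableOn_exp_mul_Iic ha x) (ae_of_all _ fun y => ?_)
  rw [norm_mul, Real.norm_eq_abs, Real.norm_eq_abs, abs_of_pos (Real.exp_pos _)]
  exact mul_le_of_le_one_right (Real.exp_pos _).le (hb y)

theorem integral_laplaceMeasure {b : ℝ} (hb : 0 < b) {h : ℝ → ℝ} (hc : Continuous h)
    (hh : ∀ x, |h x| ≤ 1) :
    ∫ x, h x ∂(laplaceMeasure 0 b) =
      b⁻¹ / 2 * (expIicIntegral b⁻¹ h 0 + expIicIntegral b⁻¹ (fun y => h (-y)) 0) := by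
  have ha : 0 < b⁻¹ := by positivity
  have h1 := integrableOn_exp_mul_Iic_of_bounded ha hc hh 0
  have h2 := integrableOn_exp_mul_Iic_of_bounded ha (h := fun y => h (-y)) (by fun_prop)
    (fun x => hh _) 0
  rw [laplaceMeasure, integral_withDensity_eq_integral_toReal_smul (by fun_prop)
    (ae_of_all _ fun _ => ENNReal.ofReal_lt_top)]
  have e : ∀ x : ℝ, (ENNReal.ofReal (1 / (2 * b) * Real.exp (-|x - 0| / b))).toReal • h x
      = b⁻¹ / 2 * (Real.exp (-|x| / b) * h x) := by
    intro x
    rw [ENNReal.toReal_ofReal (by positivity), smul_eq_mul, sub_zero]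
    field_simp
  simp_rw [e]
  rw [integral_const_mul]
  congr 1
  have e1 : ∀ x ∈ Set.Iic (0 : ℝ), Real.exp (b⁻¹ * x) * h x = Real.exp (-|x| / b) * h x := by
    intro x hx
    rw [abs_of_nonpos hx]; ring_nf
  have e2 : ∀ x ∈ Set.Ioi (0 : ℝ), Real.exp (b⁻¹ * -x) * h x = Real.exp (-|x| / b) * h x := by
    intro x hx
    rw [abs_of_pos hx]; ring_nf
  have h3 : expIicIntegral b⁻¹ (fun y => h (-y)) 0
      = ∫ x in Set.Ioi (0 : ℝ), Real.exp (b⁻¹ * -x) * h x := by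
    have := integral_comp_neg_Iic (0 : ℝ) (fun x => Real.exp (b⁻¹ * -x) * h x)
    simpa [expIicIntegral] using this
  have h4 : IntegrableOn (fun x => Real.exp (b⁻¹ * -x) * h x) (Set.Ioi (0 : ℝ)) := by
    have := (integrableOn_Ici_iff_integrableOn_Ioi).1 (IntegrableOn.comp_neg_Ici (c := 0)
      (f := fun y => Real.exp (b⁻¹ * y) * h (-y)) (by simpa using h2))
    simpa using this
  rw [h3, ← intervalIntegral.integral_Iic_add_Ioi (b := 0)
    (h1.congr_fun e1 measurableSet_Iic) (h4.congr_fun e2 measurableSet_Ioi), expIicIntegral,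
    setIntegral_congr_fun measurableSet_Iic e1, setIntegral_congr_fun measurableSet_Ioi e2]

/-- The bounded solution of the Stein equation `g - b² g'' = h` of the Laplace distribution. -/
theorem exists_laplace_stein_solution {b : ℝ} (hb : 0 < b) {h : ℝ → ℝ}
    (hh : h ∈ boundedLipschitzClass) :
    ∃ g g' G : ℝ → ℝ, (∀ x, HasDerivAt g (g' x) x) ∧ (∀ x, HasDerivAt g' (G x) x) ∧
      (∀ x, b ^ 2 * G x = g x - h x) ∧ (∀ x, |g x| ≤ 1) ∧ (∀ x, |g' x| ≤ 1 / b) ∧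
      g 0 = ∫ x, h x ∂(laplaceMeasure 0 b) := by
  have hc := continuous_of_mem_boundedLipschitzClass hh
  -- The rate a = 1/b keeps the exponents free of quotients.
  obtain ⟨a, rfl⟩ : ∃ a, b = a⁻¹ := ⟨b⁻¹, by simp⟩
  have ha : 0 < a := inv_pos.1 hb
  set A := expIicIntegral a h with hA
  set B := expIicIntegral a (fun y => h (-y)) with hB
  have dA : ∀ x, HasDerivAt A (Real.exp (a * x) * h x) x := hasDerivAt_expIicIntegral ha hc hh.1
  have dB : ∀ x, HasDerivAt (fun x => B (-x)) (-(Real.exp (-(a * x)) * h x)) x := by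
    intro x
    have := (hasDerivAt_expIicIntegral ha (h := fun y => h (-y)) (by fun_prop)
      (fun x => hh.1 _) (-x)).comp x (hasDerivAt_neg x)
    simpa [Function.comp_def, hB] using this
  have dm : ∀ x, HasDerivAt (fun x => Real.exp (-(a * x))) (-(a * Real.exp (-(a * x)))) x := by
    intro x
    have := ((hasDerivAt_id x).const_mul a).neg.exp
    simpa [mul_comm] using this
  have dp : ∀ x, HasDerivAt (fun x => Real.exp (a * x)) (a * Real.exp (a * x)) x := by
    intro x
    have := ((hasDerivAt_id x).const_mul a).exp
    simpa [mul_comm] using this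
  have hpm : ∀ x, Real.exp (-(a * x)) * Real.exp (a * x) = 1 := fun x => by
    rw [← Real.exp_add]; simp
  have bA : ∀ x, |Real.exp (-(a * x)) * A x| ≤ a⁻¹ := by
    intro x
    rw [abs_mul, abs_of_pos (Real.exp_pos _)]
    calc _ ≤ Real.exp (-(a * x)) * (Real.exp (a * x) / a) := by
          gcongr; exact abs_expIicIntegral_le ha hh.1 x
      _ = a⁻¹ := by rw [mul_div_assoc', hpm, one_div]
  have bB : ∀ x, |Real.exp (a * x) * B (-x)| ≤ a⁻¹ := by
    intro x
    rw [abs_mul, abs_of_pos (Real.exp_pos _)]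
    calc _ ≤ Real.exp (a * x) * (Real.exp (a * (-x)) / a) := by
          gcongr; exact abs_expIicIntegral_le ha (fun x => hh.1 _) (-x)
      _ = a⁻¹ := by rw [mul_div_assoc', mul_neg, mul_comm, hpm, one_div]
  -- The first function is the Green's function integral (a/2) ∫ exp(-a|x - y|) h(y) dy, split at y
  -- = x; `B (-x)` is the part over y ≥ x after reflection. In the first derivative the boundary
  -- terms containing h cancel, and in the second they add up to -a²h.
  refine ⟨fun x => a / 2 * (Real.exp (-(a * x)) * A x + Real.exp (a * x) * B (-x)),
    fun x => a ^ 2 / 2 * (Real.exp (a * x) * B (-x) - Real.exp (-(a * x)) * A x),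
    fun x => a ^ 2 * (a / 2 * (Real.exp (-(a * x)) * A x + Real.exp (a * x) * B (-x)) - h x),
    ?_, ?_, ?_, ?_, ?_, ?_⟩
  · intro x
    refine ((((dm x).mul (dA x)).add ((dp x).mul (dB x))).const_mul (a / 2)).congr_deriv ?_
    ring
  · intro x
    refine ((((dp x).mul (dB x)).sub ((dm x).mul (dA x))).const_mul (a ^ 2 / 2)).congr_deriv ?_
    linear_combination (-(a ^ 2) * h x) * hpm x
  · intro x
    field_simp
  · intro x
    rw [abs_mul, abs_of_pos (by positivity)]
    calc _ ≤ a / 2 * (a⁻¹ + a⁻¹) := by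
          gcongr; exact (abs_add_le _ _).trans (add_le_add (bA x) (bB x))
      _ = 1 := by field_simp; norm_num
  · intro x
    rw [abs_mul, abs_of_pos (by positivity)]
    calc _ ≤ a ^ 2 / 2 * (a⁻¹ + a⁻¹) := by
          gcongr; exact (abs_sub _ _).trans (add_le_add (bB x) (bA x))
      _ = 1 / a⁻¹ := by field_simp; norm_num
  · rw [integral_laplaceMeasure hb hc hh.1]
    simp [hA, hB]

/-! ### Symmetric equilibrium distributions: existence, uniqueness, first absolute moment -/

theorem isAbsCont_of_hasDerivAt {f f' : ℝ → ℝ} (hf : ∀ x, HasDerivAt f (f' x) x)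
    (hc : Continuous f') : IsAbsCont f := by
  intro a b
  have e : deriv f = f' := funext fun x => (hf x).deriv
  have : ContDiff ℝ 1 f :=
    contDiff_one_iff_deriv.2 ⟨fun x => (hf x).differentiableAt, e ▸ hc⟩
  exact this.contDiffOn.absolutelyContinuousOnInterval

/-- Integration by parts of (x - t) f''(t) on [0, x], valid for absolutely continuous f' although
f'' exists only almost everywhere, followed by the substitution t = xv. -/
theorem IsAbsCont.taylor_integral {f : ℝ → ℝ} (hf : IsAbsCont f) (hf' : IsAbsCont (deriv f))
    (x : ℝ) :
    f x - f 0 - x * deriv f 0 = x ^ 2 * ∫ v in (0 : ℝ)..1, (1 - v) * deriv (deriv f) (x * v) := by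
  rcases eq_or_ne x 0 with rfl | hx
  · simp
  have hlin : ∀ y, HasDerivAt (fun t => x - t) (-1) y := fun y => by
    simpa using (hasDerivAt_id y).const_sub x
  have h1 := (isAbsCont_of_hasDerivAt hlin continuous_const 0 x).integral_mul_deriv_eq_deriv_mul
    (hf' 0 x)
  have h2 := (hf 0 x).integral_deriv_eq_sub
  have e : deriv (fun t => x - t) = fun _ => -1 := funext fun y => (hlin y).deriv
  rw [e] at h1
  simp only [sub_self, zero_mul, neg_one_mul, intervalIntegral.integral_neg, h2] at h1
  have h3 := intervalIntegral.integral_comp_mul_left (a := 0) (b := 1)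
    (fun t => (x - t) * deriv (deriv f) t) hx
  simp only [mul_zero, mul_one, smul_eq_mul, h1] at h3
  have h4 : ∀ v, (x - x * v) * deriv (deriv f) (x * v)
      = x * ((1 - v) * deriv (deriv f) (x * v)) := fun v => by ring
  simp_rw [h4, intervalIntegral.integral_const_mul] at h3
  field_simp at h3
  rw [h3]; ring

/-- The law of `V * Y` for independent `Y`, the square-biased version of `ρ`, and `V`, with density
`v ↦ 2 * (1 - v)` on `[0, 1]`. -/
noncomputable def symmetricEquilibrium (ρ : Measure ℝ) : Measure ℝ :=
  ((ρ.prod (volume.restrict (Set.Icc (0 : ℝ) 1))).withDensity fun p =>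
    ENNReal.ofReal (p.1 ^ 2 / (∫ x, x ^ 2 ∂ρ)) * ENNReal.ofReal (2 * (1 - p.2))).map
      fun p => p.1 * p.2

section SymmetricEquilibrium

variable {ρ : Measure ℝ}

theorem lintegral_symmetricEquilibrium [SFinite ρ] {φ : ℝ → ℝ≥0∞} (hφ : Measurable φ) :
    ∫⁻ y, φ y ∂(symmetricEquilibrium ρ) =
      ∫⁻ x, ENNReal.ofReal (x ^ 2 / (∫ x, x ^ 2 ∂ρ)) *
        (∫⁻ v in Set.Icc (0 : ℝ) 1, ENNReal.ofReal (2 * (1 - v)) * φ (x * v)) ∂ρ := by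
  rw [symmetricEquilibrium, lintegral_map hφ (by fun_prop),
    lintegral_withDensity_eq_lintegral_mul _ (by fun_prop) (by fun_prop), lintegral_prod]
  · refine lintegral_congr fun x => ?_
    rw [← lintegral_const_mul _ (by fun_prop)]
    simp [mul_assoc]
  · fun_prop

theorem setLIntegral_Icc_ofReal {p : ℝ → ℝ} (hp : Continuous p)
    (hnn : ∀ v ∈ Set.Icc (0 : ℝ) 1, 0 ≤ p v) :
    ∫⁻ v in Set.Icc (0 : ℝ) 1, ENNReal.ofReal (p v) =
      ENNReal.ofReal (∫ v in (0 : ℝ)..1, p v) := by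
  rw [intervalIntegral.integral_of_le zero_le_one, ← integral_Icc_eq_integral_Ioc,
    ofReal_integral_eq_lintegral_ofReal]
  · exact hp.continuousOn.integrableOn_Icc
  · exact (ae_restrict_iff' measurableSet_Icc).2 (ae_of_all _ hnn)

theorem isProbabilityMeasure_symmetricEquilibrium [IsProbabilityMeasure ρ] (hsq : Integrable (fun x : ℝ => x ^ 2) ρ)
    (h0 : 0 < ∫ x, x ^ 2 ∂ρ) : IsProbabilityMeasure (symmetricEquilibrium ρ) := by
  constructor
  have h1 := lintegral_symmetricEquilibrium (ρ := ρ) (φ := fun _ => 1) measurable_const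
  simp only [lintegral_const, one_mul, mul_one] at h1
  rw [h1, setLIntegral_Icc_ofReal (by fun_prop) (fun v hv => by linarith [hv.2])]
  have h2 : ∫ v in (0 : ℝ)..1, 2 * (1 - v) = 1 := by
    rw [intervalIntegral.integral_const_mul, intervalIntegral.integral_sub (by simp) (by simp)]
    norm_num
  rw [h2, ENNReal.ofReal_one]
  simp only [mul_one]
  rw [← ofReal_integral_eq_lintegral_ofReal (hsq.div_const _)
    (ae_of_all _ fun x => by positivity), integral_div, div_self h0.ne', ENNReal.ofReal_one]

/-- The factor 1/3 is E V = ∫ 2v(1 - v) dv over [0, 1]; square-biasing turns E|Y| into a normalized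
third absolute moment. Both sides may be infinite. -/
theorem lintegral_abs_symmetricEquilibrium [SFinite ρ] :
    ∫⁻ y, ENNReal.ofReal |y| ∂(symmetricEquilibrium ρ) =
      1 / 3 * ∫⁻ x, ENNReal.ofReal (|x| ^ 3 / ∫ x, x ^ 2 ∂ρ) ∂ρ := by
  rw [lintegral_symmetricEquilibrium (by fun_prop), ← lintegral_const_mul _ (by fun_prop)]
  refine lintegral_congr fun x => ?_
  have hs : 0 ≤ ∫ x, x ^ 2 ∂ρ := integral_nonneg fun x => by positivity
  have e : ∀ v ∈ Set.Icc (0 : ℝ) 1, ENNReal.ofReal (2 * (1 - v)) * ENNReal.ofReal |x * v|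
      = ENNReal.ofReal (|x| * (2 * (v - v ^ 2))) := by
    intro v hv
    rw [← ENNReal.ofReal_mul (by linarith [hv.2]), abs_mul, abs_of_nonneg hv.1]
    ring_nf
  rw [setLIntegral_congr_fun measurableSet_Icc e, setLIntegral_Icc_ofReal (by fun_prop)]
  · have h2 : ∫ v in (0 : ℝ)..1, |x| * (2 * (v - v ^ 2)) = |x| / 3 := by
      rw [intervalIntegral.integral_const_mul, intervalIntegral.integral_const_mul,
        intervalIntegral.integral_sub (by simp) (by simp)]
      norm_num
      ring
    have h3 : (1 / 3 : ℝ≥0∞) = ENNReal.ofReal (1 / 3) := by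
      rw [ENNReal.ofReal_div_of_pos (by norm_num)]; simp
    rw [h2, h3, ← ENNReal.ofReal_mul (by positivity), ← ENNReal.ofReal_mul (by positivity),
      ← sq_abs]
    congr 1
    ring
  · intro v hv
    have : 0 ≤ v * (1 - v) := mul_nonneg hv.1 (by linarith [hv.2])
    have h2 : 0 ≤ v - v ^ 2 := by linarith
    positivity

theorem integrable_id_of_integrable_sq [IsProbabilityMeasure ρ] (hsq : Integrable (fun x : ℝ => x ^ 2) ρ) :
    Integrable (fun x : ℝ => x) ρ :=
  ((memLp_two_iff_integrable_sq (by fun_prop)).2 hsq).integrable (by norm_num)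

/-- Integrating f'' against the density of (Y, V), the inner integral over v is the Taylor remainder
of f, up to the factor 2/E[X²]. The linear term x f'(0) disappears because the mean is zero. -/
theorem isSymmetricEquilibrium_symmetricEquilibrium [IsProbabilityMeasure ρ] (hsq : Integrable (fun x : ℝ => x ^ 2) ρ)
    (h0 : 0 < ∫ x, x ^ 2 ∂ρ) (hmean : ∫ x, x ∂ρ = 0) :
    IsSymmetricEquilibrium ρ (symmetricEquilibrium ρ) := by
  refine ⟨isProbabilityMeasure_symmetricEquilibrium hsq h0, hsq, fun f hf hf' hif _ hif'' => ?_⟩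
  set σ2 := ∫ x, x ^ 2 ∂ρ with hσ2
  have hm : Measurable (deriv (deriv f)) := measurable_deriv _
  have hd : Measurable fun p : ℝ × ℝ =>
      ENNReal.ofReal (p.1 ^ 2 / σ2) * ENNReal.ofReal (2 * (1 - p.2)) := by fun_prop
  have hfin : ∀ p : ℝ × ℝ,
      ENNReal.ofReal (p.1 ^ 2 / σ2) * ENNReal.ofReal (2 * (1 - p.2)) < ∞ :=
    fun p => ENNReal.mul_lt_top ENNReal.ofReal_lt_top ENNReal.ofReal_lt_top
  -- Integrability of f'' under the image law, pulled back to the product space, is exactly what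
  -- Fubini requires.
  have hi2 := hif''
  rw [symmetricEquilibrium, integrable_map_measure hm.aestronglyMeasurable (by fun_prop),
    integrable_withDensity_iff_integrable_smul' hd (ae_of_all _ hfin)] at hi2
  simp only [Function.comp_apply] at hi2
  rw [symmetricEquilibrium, integral_map (by fun_prop) hm.aestronglyMeasurable,
    integral_withDensity_eq_integral_toReal_smul hd (ae_of_all _ hfin), integral_prod _ hi2]
  have key : ∀ x, ∫ v in Set.Icc (0 : ℝ) 1, (ENNReal.ofReal (x ^ 2 / σ2) *
      ENNReal.ofReal (2 * (1 - v))).toReal • deriv (deriv f) (x * v)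
      = 2 / σ2 * (f x - f 0 - x * deriv f 0) := by
    intro x
    rw [hf.taylor_integral hf' x, intervalIntegral.integral_of_le zero_le_one,
      ← integral_Icc_eq_integral_Ioc, ← mul_assoc, ← integral_const_mul]
    refine setIntegral_congr_fun measurableSet_Icc fun v hv => ?_
    simp only [smul_eq_mul]
    rw [ENNReal.toReal_mul, ENNReal.toReal_ofReal (by positivity),
      ENNReal.toReal_ofReal (by linarith [hv.2])]
    ring
  simp only
  simp_rw [key]
  rw [integral_const_mul, integral_sub (f := fun x => f x - f 0) (hif.sub (integrable_const _))
    ((integrable_id_of_integrable_sq hsq).mul_const _), integral_sub hif (integrable_const _),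
    integral_mul_const, hmean]
  simp
  field_simp

theorem IsSymmetricEquilibrium.integral_eq_of_hasDerivAt {ρL : Measure ℝ}
    (H : IsSymmetricEquilibrium ρ ρL) {f f' G : ℝ → ℝ} (hf : ∀ x, HasDerivAt f (f' x) x)
    (hf' : ∀ x, HasDerivAt f' (G x) x) (hG : Continuous G) {C : ℝ} (hC : ∀ x, |G x| ≤ C)
    (hif : Integrable f ρ) (hif' : Integrable f' ρ) :
    (∫ x, f x ∂ρ) - f 0 = 1 / 2 * (∫ x, x ^ 2 ∂ρ) * ∫ x, G x ∂ρL := by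
  have := H.isProbabilityMeasure
  have e : deriv f = f' := funext fun x => (hf x).deriv
  have e' : deriv f' = G := funext fun x => (hf' x).deriv
  have hc' : Continuous f' := continuous_iff_continuousAt.2 fun x => (hf' x).continuousAt
  have := H.integral_eq f (isAbsCont_of_hasDerivAt hf hc') (e ▸ isAbsCont_of_hasDerivAt hf' hG)
    hif (e ▸ hif')
  rw [e, e'] at this
  exact this (Integrable.of_bound hG.aestronglyMeasurable C (ae_of_all _ hC))

/-- Every bounded continuous φ is the second derivative of its double primitive f, which satisfies
|f(x)| ≤ ‖φ‖x² and is therefore an admissible test function. A positive second moment allows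
division by it; for X = 0 every law would qualify. -/
theorem IsSymmetricEquilibrium.unique [IsProbabilityMeasure ρ] {ρL ρL' : Measure ℝ} (H : IsSymmetricEquilibrium ρ ρL)
    (H' : IsSymmetricEquilibrium ρ ρL') (h0 : 0 < ∫ x, x ^ 2 ∂ρ) : ρL = ρL' := by
  have := H.isProbabilityMeasure
  have := H'.isProbabilityMeasure
  refine ext_of_forall_integral_eq_of_IsFiniteMeasure fun φ => ?_
  set f1 : ℝ → ℝ := fun x => ∫ t in (0 : ℝ)..x, φ t with hf1
  set f : ℝ → ℝ := fun x => ∫ t in (0 : ℝ)..x, f1 t with hf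
  have d1 : ∀ x, HasDerivAt f1 (φ x) x := fun x =>
    (φ.continuous.integral_hasStrictDerivAt 0 x).hasDerivAt
  have c1 : Continuous f1 := continuous_iff_continuousAt.2 fun x => (d1 x).continuousAt
  have d : ∀ x, HasDerivAt f (f1 x) x := fun x => (c1.integral_hasStrictDerivAt 0 x).hasDerivAt
  have c : Continuous f := continuous_iff_continuousAt.2 fun x => (d x).continuousAt
  have b1 : ∀ x, |f1 x| ≤ ‖φ‖ * |x| := fun x => by
    simpa using intervalIntegral.norm_integral_le_of_norm_le_const (a := 0) (b := x) (f := φ)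
      (C := ‖φ‖) fun t _ => φ.norm_coe_le_norm t
  have b : ∀ x, |f x| ≤ ‖φ‖ * x ^ 2 := fun x => by
    have := intervalIntegral.norm_integral_le_of_norm_le_const (a := 0) (b := x) (f := f1)
      (C := ‖φ‖ * |x|) fun t ht => (b1 t).trans (by
        refine mul_le_mul_of_nonneg_left ?_ (norm_nonneg _)
        rcases Set.mem_uIoc.1 ht with h | h
        · rw [abs_of_pos h.1, abs_of_nonneg (h.1.le.trans h.2)]; exact h.2
        · rw [abs_of_nonpos h.2, abs_of_neg (h.1.trans_le h.2)]; linarith [h.1])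
    rw [sub_zero, mul_assoc, abs_mul_abs_self, ← sq] at this
    exact this
  have hif : Integrable f ρ :=
    (H.integrable_sq.const_mul ‖φ‖).mono' c.aestronglyMeasurable (ae_of_all _ b)
  have hif1 : Integrable f1 ρ :=
    ((integrable_id_of_integrable_sq H.integrable_sq).abs.const_mul ‖φ‖).mono'
      c1.aestronglyMeasurable (ae_of_all _ b1)
  have h1 := H.integral_eq_of_hasDerivAt d d1 φ.continuous φ.norm_coe_le_norm hif hif1
  have h2 := H'.integral_eq_of_hasDerivAt d d1 φ.continuous φ.norm_coe_le_norm hif hif1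
  exact mul_left_cancel₀ (by positivity) (h1.symm.trans h2)

end SymmetricEquilibrium

/-! ### Fubini for functions of an independent pair -/

section Independence

variable {Ω α β : Type*} {_ : MeasurableSpace Ω} {_ : MeasurableSpace α} {_ : MeasurableSpace β}
  {P : Measure Ω} [IsProbabilityMeasure P] {U : Ω → α} {Z : Ω → β}

theorem ProbabilityTheory.IndepFun.lintegral_pair (h : IndepFun U Z P) (hU : Measurable U)
    (hZ : Measurable Z) {f : α × β → ℝ≥0∞} (hf : Measurable f) :
    ∫⁻ ω, f (U ω, Z ω) ∂P = ∫⁻ ω, ∫⁻ ω', f (U ω, Z ω') ∂P ∂P := by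
  have : IsProbabilityMeasure (P.map Z) := Measure.isProbabilityMeasure_map hZ.aemeasurable
  rw [← lintegral_map (f := f) (g := fun ω => (U ω, Z ω)) hf (hU.prodMk hZ),
    (indepFun_iff_map_prod_eq_prod_map_map hU.aemeasurable hZ.aemeasurable).1 h,
    lintegral_prod _ hf.aemeasurable, lintegral_map hf.lintegral_prod_right' hU]
  refine lintegral_congr fun ω => ?_
  rw [lintegral_map (by fun_prop) hZ]

theorem ProbabilityTheory.IndepFun.integral_pair (h : IndepFun U Z P) (hU : Measurable U)
    (hZ : Measurable Z) {f : α × β → ℝ} (hf : Measurable f) {C : ℝ} (hC : ∀ p, |f p| ≤ C) :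
    ∫ ω, f (U ω, Z ω) ∂P = ∫ ω, ∫ ω', f (U ω, Z ω') ∂P ∂P := by
  have : IsProbabilityMeasure (P.map Z) := Measure.isProbabilityMeasure_map hZ.aemeasurable
  have : IsProbabilityMeasure (P.map U) := Measure.isProbabilityMeasure_map hU.aemeasurable
  rw [← integral_map (f := f) (φ := fun ω => (U ω, Z ω)) (hU.prodMk hZ).aemeasurable
      hf.aestronglyMeasurable,
    (indepFun_iff_map_prod_eq_prod_map_map hU.aemeasurable hZ.aemeasurable).1 h,
    integral_prod _ (Integrable.of_bound hf.aestronglyMeasurable C (ae_of_all _ hC)),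
    integral_map hU.aemeasurable
      hf.stronglyMeasurable.integral_prod_right'.aestronglyMeasurable]
  refine integral_congr_ae (ae_of_all _ fun ω => ?_)
  simp only
  exact integral_map hZ.aemeasurable (hf.comp measurable_prodMk_left).aestronglyMeasurable

end Independence

theorem abs_integral_le_of_abs_le {α : Type*} {_ : MeasurableSpace α} {P : Measure α}
    [IsProbabilityMeasure P] {f : α → ℝ} {C : ℝ} (hC : ∀ x, |f x| ≤ C) : |∫ x, f x ∂P| ≤ C := by
  simpa using norm_integral_le_of_norm_le_const (μ := P) (f := f) (ae_of_all _ hC)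

/-! ### Moments of sums of independent centered variables -/

/-- A sequence of independent centered real random variables `Y i` of variance `τ i ^ 2`. -/
structure IsCenteredIndep {Ω : Type*} [MeasurableSpace Ω] (P : Measure Ω) (Y : ℕ → Ω → ℝ)
    (τ : ℕ → ℝ) : Prop where
  measurable : ∀ i, Measurable (Y i)
  indep : iIndepFun Y P
  memLp : ∀ i, MemLp (Y i) 2 P
  mean : ∀ i, ∫ ω, Y i ω ∂P = 0
  nonneg : ∀ i, 0 ≤ τ i
  sq : ∀ i, ∫ ω, (Y i ω) ^ 2 ∂P = τ i ^ 2

namespace IsCenteredIndep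

variable {Ω : Type*} [MeasurableSpace Ω] {P : Measure Ω} [IsProbabilityMeasure P]
  {Y : ℕ → Ω → ℝ} {τ : ℕ → ℝ}

theorem integral_sq_sum (H : IsCenteredIndep P Y τ) (I : Finset ℕ) :
    ∫ ω, (∑ i ∈ I, Y i ω) ^ 2 ∂P = ∑ i ∈ I, τ i ^ 2 := by
  have h := IndepFun.variance_sum (s := I) (fun i _ => H.memLp i)
    (fun i _ j _ hij => H.indep.indepFun hij)
  have hv : ∀ i, Var[Y i; P] = τ i ^ 2 := fun i => by
    rw [variance_of_integral_eq_zero (H.measurable i).aemeasurable (H.mean i), H.sq]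
  have hm : AEMeasurable (∑ i ∈ I, Y i) P := by
    rw [Finset.sum_fn]
    exact (Finset.measurable_sum I fun i _ => H.measurable i).aemeasurable
  have h0 : ∫ ω, (∑ i ∈ I, Y i) ω ∂P = 0 := by
    simp only [Finset.sum_apply]
    rw [integral_finsetSum _ fun i _ => (H.memLp i).integrable (by norm_num)]
    exact Finset.sum_eq_zero fun i _ => H.mean i
  rw [variance_of_integral_eq_zero hm h0] at h
  simpa [hv] using h

theorem lintegral_sq_sum (H : IsCenteredIndep P Y τ) (I : Finset ℕ) :
    ∫⁻ ω, ENNReal.ofReal ((∑ i ∈ I, Y i ω) ^ 2) ∂P = ENNReal.ofReal (∑ i ∈ I, τ i ^ 2) := by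
  rw [← H.integral_sq_sum I, ofReal_integral_eq_lintegral_ofReal]
  · exact (memLp_finsetSum I fun i _ => H.memLp i).integrable_sq
  · exact ae_of_all _ fun ω => by positivity

/-- Cauchy–Schwarz bounds the first absolute moment by the root of the variance sum, which is at
most the number of terms times the squared supremum. In extended nonnegative reals the supremum may
be infinite. -/
theorem lintegral_abs_sum_le (H : IsCenteredIndep P Y τ) (I : Finset ℕ) :
    ∫⁻ ω, ENNReal.ofReal |∑ i ∈ I, Y i ω| ∂P ≤
      (⨆ i, ENNReal.ofReal (τ i)) * ENNReal.ofReal ((I.card : ℝ) ^ (1 / 2 : ℝ)) := by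
  set K := ⨆ i, ENNReal.ofReal (τ i)
  have hm : Measurable fun ω => ENNReal.ofReal |∑ i ∈ I, Y i ω| := by
    have := H.measurable
    fun_prop
  have h1 := ENNReal.lintegral_mul_le_Lp_mul_Lq P Real.HolderConjugate.two_two hm.aemeasurable
    (aemeasurable_const (b := (1 : ℝ≥0∞)))
  have e : ∀ ω, ENNReal.ofReal |∑ i ∈ I, Y i ω| ^ (2 : ℝ)
      = ENNReal.ofReal ((∑ i ∈ I, Y i ω) ^ 2) := fun ω => by
    rw [ENNReal.rpow_two, ← ENNReal.ofReal_pow (abs_nonneg _), sq_abs]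
  simp only [e, Pi.mul_apply, mul_one, ENNReal.one_rpow, lintegral_const, measure_univ,
    H.lintegral_sq_sum] at h1
  refine h1.trans ?_
  have h2 : ENNReal.ofReal (∑ i ∈ I, τ i ^ 2) ≤ K ^ (2 : ℝ) * (I.card : ℝ≥0∞) := by
    rw [ENNReal.ofReal_sum_of_nonneg fun i _ => by positivity]
    calc _ ≤ ∑ i ∈ I, K ^ (2 : ℝ) := Finset.sum_le_sum fun i _ => by
          rw [ENNReal.ofReal_pow (H.nonneg i), ENNReal.rpow_two]
          gcongr
          exact le_iSup (fun i => ENNReal.ofReal (τ i)) i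
      _ = _ := by simp [mul_comm]
  calc _ ≤ (K ^ (2 : ℝ) * (I.card : ℝ≥0∞)) ^ (1 / 2 : ℝ) := by gcongr
    _ = _ := by
      rw [ENNReal.mul_rpow_of_nonneg _ _ (by norm_num), ← ENNReal.rpow_mul,
        ← ENNReal.ofReal_rpow_of_nonneg (by positivity) (by norm_num), ENNReal.ofReal_natCast]
      norm_num

end IsCenteredIndep

/-! ### Sums weighted by the law of a random index -/

section Weights

variable {Ω : Type*} [MeasurableSpace Ω] {P : Measure Ω} [IsProbabilityMeasure P]
  {τ : ℕ → ℝ} {N : Ω → ℕ} {s : ℝ}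

/-- Writing the random sum as a series with indicators of m < N, expectation and series may be
exchanged because d is bounded and the variance weights are summable. -/
theorem hasSum_weights (hN : Measurable N)
    (hint : Integrable (fun ω => ∑ i ∈ Finset.range (N ω), τ i ^ 2) P) {d : ℕ → ℝ} {C : ℝ}
    (hd : ∀ m, |d m| ≤ C) :
    HasSum (fun m => τ m ^ 2 * d m * P.real {ω | m < N ω})
      (∫ ω, ∑ m ∈ Finset.range (N ω), τ m ^ 2 * d m ∂P) := by
  have hms : ∀ m, MeasurableSet {ω | m < N ω} := fun m => measurableSet_lt measurable_const hN
  have hi : ∀ (e : ℕ → ℝ) m, Integrable ({ω | m < N ω}.indicator fun _ => e m) P :=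
    fun e m => (integrable_const _).indicator (hms m)
  have hv : ∀ (e : ℕ → ℝ) m, ∫ ω, {ω | m < N ω}.indicator (fun _ => e m) ω ∂P
      = e m * P.real {ω | m < N ω} := fun e m => by
    rw [integral_indicator_const _ (hms m), smul_eq_mul, mul_comm]
  -- Each finite partial sum is the mean of a truncation of the random variance sum, hence at most
  -- its mean.
  have hS : Summable fun m => τ m ^ 2 * P.real {ω | m < N ω} := by
    refine summable_of_sum_range_le (c := ∫ ω, ∑ i ∈ Finset.range (N ω), τ i ^ 2 ∂P)
      (fun m => by positivity) fun n => ?_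
    simp_rw [← hv fun m => τ m ^ 2]
    rw [← integral_finsetSum _ fun i _ => hi (fun m => τ m ^ 2) i]
    refine integral_mono (integrable_finsetSum _ fun i _ => hi (fun m => τ m ^ 2) i) hint
      fun ω => ?_
    simp only [Set.indicator_apply, Set.mem_ofPred_eq]
    rw [← Finset.sum_filter]
    exact Finset.sum_le_sum_of_subset_of_nonneg (fun i hi => by simp_all)
      fun i _ _ => by positivity
  have hS' : Summable fun m => ∫ ω, ‖{ω | m < N ω}.indicator (fun _ => τ m ^ 2 * d m) ω‖ ∂P := by
    refine (hS.mul_left C).of_nonneg_of_le (fun m => integral_nonneg fun _ => norm_nonneg _)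
      fun m => ?_
    simp_rw [norm_indicator_eq_indicator_norm]
    rw [hv fun m => ‖τ m ^ 2 * d m‖, norm_mul, Real.norm_eq_abs, Real.norm_eq_abs,
      abs_of_nonneg (sq_nonneg _), ← mul_assoc, mul_comm C]
    gcongr
    exact hd m
  have := hasSum_integral_of_summable_integral_norm (hi fun m => τ m ^ 2 * d m) hS'
  simp_rw [hv fun m => τ m ^ 2 * d m] at this
  convert! this using 3 with ω
  rw [tsum_eq_sum (s := Finset.range (N ω)) fun m hm =>
    Set.indicator_of_notMem (by simpa using hm) _]
  exact Finset.sum_congr rfl fun m hm => by simp_all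

theorem hasSum_integral_comp_nat {K : Ω → ℕ} (hK : Measurable K) {d : ℕ → ℝ} {C : ℝ}
    (hd : ∀ m, |d m| ≤ C) : HasSum (fun m => P.real {ω | K ω = m} * d m) (∫ ω, d (K ω) ∂P) := by
  have hm : Measurable fun ω => d (K ω) := (measurable_of_countable d).comp hK
  have hs : ∀ m, MeasurableSet {ω | K ω = m} := fun m => hK (measurableSet_singleton m)
  have hi : Integrable (fun ω => d (K ω)) P :=
    Integrable.of_bound hm.aestronglyMeasurable C (ae_of_all _ fun ω => hd _)
  have h := hasSum_integral_iUnion (f := fun ω => d (K ω)) hs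
    (fun i j hij => Set.disjoint_left.2 fun ω hi hj => hij (hi.symm.trans hj)) hi.integrableOn
  have hu : ⋃ m, {ω | K ω = m} = Set.univ := Set.eq_univ_of_forall fun ω => by simp
  rw [hu, setIntegral_univ] at h
  refine h.congr_fun fun m => ?_
  rw [setIntegral_congr_fun (g := fun _ => d m) (hs m) fun ω hω => congrArg d hω]
  simp

end Weights

/-! ### Telescoping with the equilibrium identity -/

/-- The partial sums `Y 0 + ⋯ + Y (n - 1)`. -/
def partialSum {Ω : Type*} (Y : ℕ → Ω → ℝ) (n : ℕ) (ω : Ω) : ℝ := ∑ i ∈ Finset.range n, Y i ω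

theorem measurable_integral_add {ρ : Measure ℝ} [SFinite ρ] {G : ℝ → ℝ} (hG : Measurable G) :
    Measurable fun a => ∫ y, G (a + y) ∂ρ :=
  (StronglyMeasurable.integral_prod_right' (f := fun p : ℝ × ℝ => G (p.1 + p.2))
    (hG.comp measurable_add).stronglyMeasurable).measurable

namespace IsCenteredIndep

variable {Ω : Type*} [MeasurableSpace Ω] {P : Measure Ω} [IsProbabilityMeasure P]
  {Y : ℕ → Ω → ℝ} {τ : ℕ → ℝ}

omit [IsProbabilityMeasure P] in
theorem measurable_partialSum (H : IsCenteredIndep P Y τ) (n : ℕ) : Measurable (partialSum Y n) :=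
  Finset.measurable_sum _ fun i _ => H.measurable i

omit [IsProbabilityMeasure P] in
theorem indepFun_partialSum (H : IsCenteredIndep P Y τ) (n : ℕ) :
    IndepFun (partialSum Y n) (Y n) P := by
  have := H.indep.indepFun_finsetSum_of_notMem H.measurable
    (Finset.notMem_range_self (n := n))
  rwa [Finset.sum_fn] at this

/-- By independence the first n summands may be frozen at a value a; the equilibrium identity for x
↦ g(a + x) then replaces the last summand by its equilibrium law and produces the factor τ²/2. -/
theorem integral_comp_partialSum_succ (H : IsCenteredIndep P Y τ) {Q : ℕ → Measure ℝ}
    (hQ : ∀ i, IsSymmetricEquilibrium (P.map (Y i)) (Q i)) {g g' G : ℝ → ℝ}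
    (hg : ∀ x, HasDerivAt g (g' x) x) (hg' : ∀ x, HasDerivAt g' (G x) x) (hG : Continuous G)
    {C C' D : ℝ} (hC : ∀ x, |g x| ≤ C) (hC' : ∀ x, |g' x| ≤ C') (hD : ∀ x, |G x| ≤ D) (n : ℕ) :
    ∫ ω, g (partialSum Y (n + 1) ω) ∂P = ∫ ω, g (partialSum Y n ω) ∂P +
      τ n ^ 2 * (1 / 2 * ∫ ω, ∫ y, G (partialSum Y n ω + y) ∂(Q n) ∂P) := by
  have := (hQ n).isProbabilityMeasure
  have : IsProbabilityMeasure (P.map (Y n)) :=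
    Measure.isProbabilityMeasure_map (H.measurable n).aemeasurable
  have cg : Continuous g := continuous_iff_continuousAt.2 fun x => (hg x).continuousAt
  have cg' : Continuous g' := continuous_iff_continuousAt.2 fun x => (hg' x).continuousAt
  have hS := H.measurable_partialSum n
  have h1 := (H.indepFun_partialSum n).integral_pair hS (H.measurable n)
    (f := fun p => g (p.1 + p.2)) (by fun_prop) (fun p => hC _)
  have h2 : ∀ a, ∫ ω, g (a + Y n ω) ∂P
      = g a + τ n ^ 2 * (1 / 2) * ∫ y, G (a + y) ∂(Q n) := by
    intro a
    have h3 := (hQ n).integral_eq_of_hasDerivAt (f := fun x => g (a + x))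
      (f' := fun x => g' (a + x)) (G := fun x => G (a + x)) (fun x => (hg _).comp_const_add a x)
      (fun x => (hg' _).comp_const_add a x) (by fun_prop) (fun x => hD _)
      (Integrable.of_bound (by fun_prop) C (ae_of_all _ fun x => hC _))
      (Integrable.of_bound (by fun_prop) C' (ae_of_all _ fun x => hC' _))
    rw [integral_map (H.measurable n).aemeasurable (by fun_prop),
      integral_map (H.measurable n).aemeasurable (by fun_prop), H.sq, add_zero] at h3
    linear_combination h3
  have hk := measurable_integral_add (ρ := Q n) hG.measurable
  simp only [h2] at h1
  simp only [partialSum, Finset.sum_range_succ] at h1 ⊢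
  rw [h1, integral_add, integral_const_mul, mul_assoc]
  · exact Integrable.of_bound (cg.measurable.comp hS).aestronglyMeasurable C
      (ae_of_all _ fun ω => hC _)
  · exact (Integrable.of_bound (hk.comp hS).aestronglyMeasurable D
      (ae_of_all _ fun ω => abs_integral_le_of_abs_le fun y => hD _)).const_mul _

theorem integral_comp_partialSum (H : IsCenteredIndep P Y τ) {Q : ℕ → Measure ℝ}
    (hQ : ∀ i, IsSymmetricEquilibrium (P.map (Y i)) (Q i)) {g g' G : ℝ → ℝ}
    (hg : ∀ x, HasDerivAt g (g' x) x) (hg' : ∀ x, HasDerivAt g' (G x) x) (hG : Continuous G)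
    {C C' D : ℝ} (hC : ∀ x, |g x| ≤ C) (hC' : ∀ x, |g' x| ≤ C') (hD : ∀ x, |G x| ≤ D) (n : ℕ) :
    ∫ ω, g (partialSum Y n ω) ∂P = g 0 + ∑ m ∈ Finset.range n,
      τ m ^ 2 * (1 / 2 * ∫ ω, ∫ y, G (partialSum Y m ω + y) ∂(Q m) ∂P) := by
  induction n with
  | zero => simp [partialSum]
  | succ n ih =>
    rw [H.integral_comp_partialSum_succ hQ hg hg' hG hC hC' hD, ih, Finset.sum_range_succ,
      add_assoc]

end IsCenteredIndep

/-! ### Random sums and the random index -/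

/-- A random sum of the `Y i` with `N` summands, of second moment `s ^ 2`, together with the random
index `K` picking a summand proportionally to its contribution to `s ^ 2`. -/
structure IsRandomSum {Ω : Type*} [MeasurableSpace Ω] (P : Measure Ω) (Y : ℕ → Ω → ℝ)
    (τ : ℕ → ℝ) (N K : Ω → ℕ) (s : ℝ) : Prop extends IsCenteredIndep P Y τ where
  measurable_card : Measurable N
  measurable_index : Measurable K
  indep_pair : IndepFun (fun ω => (N ω, K ω)) (fun ω i => Y i ω) P
  integrable : Integrable (fun ω => ∑ i ∈ Finset.range (N ω), τ i ^ 2) P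
  pos : 0 < s
  sq_eq : s ^ 2 = ∫ ω, ∑ i ∈ Finset.range (N ω), τ i ^ 2 ∂P
  index_eq : ∀ m, P.real {ω | K ω = m} = τ m ^ 2 / s ^ 2 * P.real {ω | m < N ω}

theorem measurable_comp_index {Ω β γ : Type*} [MeasurableSpace Ω] [MeasurableSpace β]
    [MeasurableSpace γ] {K : Ω → ℕ} {Z : Ω → β} (hK : Measurable K) (hZ : Measurable Z)
    {F : ℕ → β → γ} (hF : ∀ m, Measurable (F m)) : Measurable fun ω => F (K ω) (Z ω) :=
  (measurable_from_prod_countable_right (f := fun p : ℕ × β => F p.1 p.2) hF).comp (hK.prodMk hZ)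

theorem measurable_partialSum_pi (n : ℕ) :
    Measurable fun z : ℕ → ℝ => ∑ i ∈ Finset.range n, z i := by fun_prop

namespace IsRandomSum

variable {Ω : Type*} [MeasurableSpace Ω] {P : Measure Ω} [IsProbabilityMeasure P]
  {Y : ℕ → Ω → ℝ} {τ : ℕ → ℝ} {N K : Ω → ℕ} {s : ℝ}

omit [IsProbabilityMeasure P] in
theorem measurable_pi (H : IsRandomSum P Y τ N K s) : Measurable fun ω i => Y i ω :=
  measurable_pi_lambda _ H.measurable

omit [IsProbabilityMeasure P] in
theorem indep_card (H : IsRandomSum P Y τ N K s) : IndepFun N (fun ω i => Y i ω) P :=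
  H.indep_pair.comp measurable_fst measurable_id

omit [IsProbabilityMeasure P] in
theorem indep_index (H : IsRandomSum P Y τ N K s) : IndepFun K (fun ω i => Y i ω) P :=
  H.indep_pair.comp measurable_snd measurable_id

/-- The law of K is made for this: s² P(K = m) equals the weight τ_m² P(N > m), so both sides are
the same series. -/
theorem integral_sum_eq (H : IsRandomSum P Y τ N K s) {d : ℕ → ℝ} {C : ℝ}
    (hd : ∀ m, |d m| ≤ C) :
    ∫ ω, ∑ m ∈ Finset.range (N ω), τ m ^ 2 * d m ∂P = s ^ 2 * ∫ ω, d (K ω) ∂P := by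
  have h1 := hasSum_weights (P := P) H.measurable_card H.integrable hd
  have h2 := (hasSum_integral_comp_nat (P := P) H.measurable_index hd).mul_left (s ^ 2)
  refine h1.unique (h2.congr_fun fun m => ?_)
  have := H.pos
  rw [H.index_eq]
  field_simp

/-- Telescoping is done for fixed n and averaged over N, which is independent of the summands. The
variable ω' is an independent copy of the sample point; independence of K later identifies it with
ω. -/
theorem integral_comp_partialSum_card (H : IsRandomSum P Y τ N K s) {Q : ℕ → Measure ℝ}
    (hQ : ∀ i, IsSymmetricEquilibrium (P.map (Y i)) (Q i)) {g g' G : ℝ → ℝ}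
    (hg : ∀ x, HasDerivAt g (g' x) x) (hg' : ∀ x, HasDerivAt g' (G x) x) (hG : Continuous G)
    {C C' D : ℝ} (hC : ∀ x, |g x| ≤ C) (hC' : ∀ x, |g' x| ≤ C') (hD : ∀ x, |G x| ≤ D) :
    ∫ ω, g (partialSum Y (N ω) ω) ∂P = g 0 +
      s ^ 2 / 2 * ∫ ω, ∫ ω', ∫ y, G (partialSum Y (K ω) ω' + y) ∂(Q (K ω)) ∂P ∂P := by
  have cg : Continuous g := continuous_iff_continuousAt.2 fun x => (hg x).continuousAt
  have hb : ∀ m, |∫ ω, ∫ y, G (partialSum Y m ω + y) ∂(Q m) ∂P| ≤ D := fun m => by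
    have := (hQ m).isProbabilityMeasure
    exact abs_integral_le_of_abs_le (P := P) fun ω => abs_integral_le_of_abs_le fun y => hD _
  have hb' : ∀ m, |1 / 2 * ∫ ω, ∫ y, G (partialSum Y m ω + y) ∂(Q m) ∂P| ≤ D := fun m => by
    rw [abs_mul, abs_of_pos (by norm_num : (0 : ℝ) < 1 / 2)]
    linarith [hb m, abs_nonneg (∫ ω, ∫ y, G (partialSum Y m ω + y) ∂(Q m) ∂P)]
  have h1 := H.indep_card.integral_pair H.measurable_card H.measurable_pi
    (f := fun p => g (∑ i ∈ Finset.range p.1, p.2 i))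
    (measurable_from_prod_countable_right fun n =>
      cg.measurable.comp (measurable_partialSum_pi n)) (fun p => hC _)
  have h2 := fun n => H.integral_comp_partialSum hQ hg hg' hG hC hC' hD n
  simp only [partialSum] at h1 h2 ⊢ hb'
  rw [h1]
  simp only [h2]
  have hi : Integrable (fun ω => ∑ m ∈ Finset.range (N ω), τ m ^ 2 * (1 / 2 * ∫ ω, ∫ y,
      G (∑ i ∈ Finset.range m, Y i ω + y) ∂(Q m) ∂P)) P := by
    refine (H.integrable.mul_const D).mono' ?_ (ae_of_all _ fun ω => ?_)
    · exact ((measurable_of_countable fun n => ∑ m ∈ Finset.range n, τ m ^ 2 * (1 / 2 *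
        ∫ ω, ∫ y, G (∑ i ∈ Finset.range m, Y i ω + y) ∂(Q m) ∂P)).comp
        H.measurable_card).aestronglyMeasurable
    · rw [Finset.sum_mul]
      refine norm_sum_le_of_le _ fun m _ => ?_
      rw [norm_mul, Real.norm_eq_abs, Real.norm_eq_abs, abs_of_nonneg (sq_nonneg _)]
      gcongr
      exact hb' m
  rw [integral_add (integrable_const _) hi, H.integral_sum_eq hb', integral_const_mul]
  simp
  ring

end IsRandomSum

/-! ### Moment bounds and the Stein representation of the error -/

theorem abs_sub_le_of_hasDerivAt {g g' : ℝ → ℝ} {C : ℝ} (hg : ∀ x, HasDerivAt g (g' x) x)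
    (hC : ∀ x, |g' x| ≤ C) (x y : ℝ) : |g x - g y| ≤ C * |x - y| :=
  Convex.norm_image_sub_le_of_norm_hasDerivWithin_le (s := Set.univ)
    (fun z _ => (hg z).hasDerivWithinAt) (fun z _ => hC z) convex_univ trivial trivial

theorem dBL_map_le {Ω : Type*} [MeasurableSpace Ω] {P : Measure Ω} {V : Ω → ℝ}
    (hV : Measurable V) {ρ : Measure ℝ} {B : ℝ≥0∞}
    (hB : ∀ h ∈ boundedLipschitzClass,
      ENNReal.ofReal |∫ ω, h (V ω) ∂P - ∫ x, h x ∂ρ| ≤ B) : dBL (P.map V) ρ ≤ B := by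
  refine iSup₂_le fun h hh => ?_
  rw [integral_map hV.aemeasurable
    (continuous_of_mem_boundedLipschitzClass hh).aestronglyMeasurable]
  exact hB h hh

theorem abs_sum_range_sub_sum_range (f : ℕ → ℝ) (n m : ℕ) :
    |∑ i ∈ Finset.range n, f i - ∑ i ∈ Finset.range m, f i| =
      |∑ i ∈ Finset.Ico (min n m) (max n m), f i| := by
  rcases le_total m n with h | h
  · rw [min_eq_right h, max_eq_left h, Finset.sum_Ico_eq_sub _ h]
  · rw [min_eq_left h, max_eq_right h, Finset.sum_Ico_eq_sub _ h, abs_sub_comm]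

theorem IsCenteredIndep.lintegral_abs_partialSum_sub_le {Ω : Type*} [MeasurableSpace Ω]
    {P : Measure Ω} [IsProbabilityMeasure P] {Y : ℕ → Ω → ℝ} {τ : ℕ → ℝ}
    (H : IsCenteredIndep P Y τ) (n m : ℕ) :
    ∫⁻ ω, ENNReal.ofReal |∑ i ∈ Finset.range n, Y i ω - ∑ i ∈ Finset.range m, Y i ω| ∂P ≤
      (⨆ i, ENNReal.ofReal (τ i)) * ENNReal.ofReal (|(n : ℝ) - m| ^ (1 / 2 : ℝ)) := by
  simp_rw [fun ω => abs_sum_range_sub_sum_range (fun i => Y i ω) n m]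
  refine (H.lintegral_abs_sum_le _).trans_eq ?_
  rw [Nat.card_Ico, Nat.cast_sub (min_le_max), Nat.cast_max, Nat.cast_min, max_sub_min_eq_abs,
    abs_sub_comm]

theorem measurable_dist_rpow {Ω : Type*} [MeasurableSpace Ω] {N K : Ω → ℕ} (hN : Measurable N)
    (hK : Measurable K) :
    Measurable fun ω => ENNReal.ofReal (|(N ω : ℝ) - (K ω + 1 : ℕ)| ^ (1 / 2 : ℝ)) := by
  have h1 : Measurable fun ω => (N ω : ℝ) := (measurable_of_countable Nat.cast).comp hN
  have h2 : Measurable fun ω => ((K ω + 1 : ℕ) : ℝ) :=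
    (measurable_of_countable Nat.cast).comp (hK.add_const 1)
  fun_prop

namespace IsRandomSum

variable {Ω : Type*} [MeasurableSpace Ω] {P : Measure Ω} [IsProbabilityMeasure P]
  {Y : ℕ → Ω → ℝ} {τ : ℕ → ℝ} {N K : Ω → ℕ} {s : ℝ}

omit [IsProbabilityMeasure P] in
theorem measurable_card_sum (H : IsRandomSum P Y τ N K s) :
    Measurable fun ω => partialSum Y (N ω) ω :=
  measurable_comp_index H.measurable_card H.measurable_pi measurable_partialSum_pi

omit [IsProbabilityMeasure P] in
theorem measurable_index_apply (H : IsRandomSum P Y τ N K s) :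
    Measurable fun ω => Y (K ω) ω :=
  measurable_comp_index (F := fun m (z : ℕ → ℝ) => z m) H.measurable_index H.measurable_pi
    measurable_pi_apply

theorem lintegral_sq_partialSum (H : IsRandomSum P Y τ N K s) :
    ∫⁻ ω, ENNReal.ofReal (partialSum Y (N ω) ω ^ 2) ∂P = ENNReal.ofReal (s ^ 2) := by
  have h := H.indep_card.lintegral_pair H.measurable_card H.measurable_pi
    (f := fun p => ENNReal.ofReal ((∑ i ∈ Finset.range p.1, p.2 i) ^ 2))
    (measurable_from_prod_countable_right fun n => by simp only; fun_prop)
  simp only [H.lintegral_sq_sum] at h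
  simp only [partialSum]
  rw [h, H.sq_eq, ofReal_integral_eq_lintegral_ofReal H.integrable]
  exact ae_of_all _ fun ω => Finset.sum_nonneg fun i _ => sq_nonneg _

theorem lintegral_abs_partialSum_sub_le (H : IsRandomSum P Y τ N K s) :
    ∫⁻ ω, ENNReal.ofReal |partialSum Y (N ω) ω - partialSum Y (K ω + 1) ω| ∂P ≤
      (⨆ i, ENNReal.ofReal (τ i)) *
        ∫⁻ ω, ENNReal.ofReal (|(N ω : ℝ) - (K ω + 1 : ℕ)| ^ (1 / 2 : ℝ)) ∂P := by
  have h := H.indep_pair.lintegral_pair (H.measurable_card.prodMk H.measurable_index)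
    H.measurable_pi (f := fun p => ENNReal.ofReal |∑ i ∈ Finset.range p.1.1, p.2 i -
      ∑ i ∈ Finset.range (p.1.2 + 1), p.2 i|)
    (measurable_from_prod_countable_right fun n => by simp only; fun_prop)
  simp only at h
  simp only [partialSum]
  rw [h, ← lintegral_const_mul _ (measurable_dist_rpow H.measurable_card H.measurable_index)]
  exact lintegral_mono fun ω => H.toIsCenteredIndep.lintegral_abs_partialSum_sub_le _ _

/-- Positive variance makes the equilibrium law unique, so the moment can be computed from the
explicit one whatever Q is. -/
theorem lintegral_abs_equilibrium (H : IsRandomSum P Y τ N K s) (hτ : ∀ i, 0 < τ i)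
    {Q : ℕ → Measure ℝ} (hQ : ∀ i, IsSymmetricEquilibrium (P.map (Y i)) (Q i)) :
    ∫⁻ ω, ∫⁻ y, ENNReal.ofReal |y| ∂(Q (K ω)) ∂P =
      1 / 3 * ∫⁻ ω, ENNReal.ofReal (|Y (K ω) ω| ^ 3 / τ (K ω) ^ 2) ∂P := by
  have h := H.indep_index.lintegral_pair H.measurable_index H.measurable_pi
    (f := fun p => ENNReal.ofReal (|p.2 p.1| ^ 3 / τ p.1 ^ 2))
    (measurable_from_prod_countable_right fun n => by simp only; fun_prop)
  simp only at h
  have hm : Measurable fun ω =>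
      ∫⁻ ω', ENNReal.ofReal (|Y (K ω) ω'| ^ 3 / τ (K ω) ^ 2) ∂P :=
    (measurable_of_countable fun k =>
      ∫⁻ ω', ENNReal.ofReal (|Y k ω'| ^ 3 / τ k ^ 2) ∂P).comp H.measurable_index
  rw [h, ← lintegral_const_mul _ hm]
  refine lintegral_congr fun ω => ?_
  set k := K ω
  have : IsProbabilityMeasure (P.map (Y k)) :=
    Measure.isProbabilityMeasure_map (H.measurable k).aemeasurable
  have hid : ∫ x, x ∂(P.map (Y k)) = 0 := by
    rw [integral_map (H.measurable k).aemeasurable (by fun_prop), H.mean]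
  have hsq : ∫ x, x ^ 2 ∂(P.map (Y k)) = τ k ^ 2 := by
    rw [integral_map (H.measurable k).aemeasurable (by fun_prop), H.sq]
  have h0 : 0 < ∫ x, x ^ 2 ∂(P.map (Y k)) := hsq ▸ pow_pos (hτ k) 2
  rw [(hQ k).unique (isSymmetricEquilibrium_symmetricEquilibrium (hQ k).integrable_sq h0 hid) h0,
    lintegral_abs_symmetricEquilibrium, hsq, lintegral_map (by fun_prop) (H.measurable k)]

/-- The core of the argument: the Stein equation turns the error into a difference of expectations
of one Lipschitz function, evaluated at the equilibrium-modified sum and at the original random sum.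
-/
theorem exists_stein_representation (H : IsRandomSum P Y τ N K s) {Q : ℕ → Measure ℝ}
    (hQ : ∀ i, IsSymmetricEquilibrium (P.map (Y i)) (Q i)) {μ : ℝ} (hμ : 0 < μ) {h : ℝ → ℝ}
    (hh : h ∈ boundedLipschitzClass) :
    ∃ F : ℝ → ℝ, Continuous F ∧ (∀ x, |F x| ≤ 2) ∧
      (∀ x y, |F x - F y| ≤ (μ ^ (-(1 / 2) : ℝ) + √8 / s) * |x - y|) ∧
      ∫ ω, h (μ ^ (-(1 / 2) : ℝ) * partialSum Y (N ω) ω) ∂P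
          - ∫ x, h x ∂(laplaceMeasure 0 (s / √(2 * μ))) =
        ∫ ω, ∫ ω', ∫ y, F (partialSum Y (K ω) ω' + y) ∂(Q (K ω)) ∂P ∂P
          - ∫ ω, F (partialSum Y (N ω) ω) ∂P := by
  have hs := H.pos
  have hb : 0 < s / √(2 * μ) := by positivity
  set c := μ ^ (-(1 / 2) : ℝ) with hc
  set b := s / √(2 * μ) with hbdef
  have hc0 : 0 < c := Real.rpow_pos_of_pos hμ _
  have hcμ : c ^ 2 * μ = 1 := by
    rw [hc, ← Real.rpow_natCast, ← Real.rpow_mul hμ.le]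
    norm_num
    rw [Real.rpow_neg_one, inv_mul_cancel₀ hμ.ne']
  have hcs : c * √μ = 1 := by
    have h1 : (c * √μ) ^ 2 = 1 := by rw [mul_pow, Real.sq_sqrt hμ.le, hcμ]
    nlinarith [mul_nonneg hc0.le (Real.sqrt_nonneg μ)]
  have hb2 : b ^ 2 * (2 * μ) = s ^ 2 := by
    rw [hbdef, div_pow, Real.sq_sqrt (by positivity)]
    field_simp
  -- The exact value is √2/s; the stated constant √8 leaves room.
  have hbc : 1 / b * c ≤ √8 / s := by
    have h28 : √2 ≤ √8 := Real.sqrt_le_sqrt (by norm_num)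
    calc 1 / b * c = √2 * (c * √μ) / s := by
          rw [hbdef, Real.sqrt_mul (by norm_num), one_div_div]; ring
      _ ≤ √8 / s := by rw [hcs, mul_one]; gcongr
  obtain ⟨g, g', G, hg, hg', hG, hg1, hgb, hg0⟩ := exists_laplace_stein_solution hb hh
  have cg : Continuous g := continuous_iff_continuousAt.2 fun x => (hg x).continuousAt
  have ch := continuous_of_mem_boundedLipschitzClass hh
  have hG' : ∀ x, G x = (g x - h x) / b ^ 2 := fun x => by
    rw [← hG x]; field_simp
  have cG : Continuous G := by
    rw [funext hG']
    fun_prop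
  have hGb : ∀ x, |b ^ 2 * G x| ≤ 2 := fun x => by
    rw [hG]
    exact (abs_sub _ _).trans (by linarith [hg1 x, hh.1 x])
  -- By the Stein equation this is (g - h)(cx): bounded by 2, with h contributing c and g
  -- contributing c/b to the Lipschitz constant.
  refine ⟨fun x => b ^ 2 * G (c * x), by fun_prop, fun x => hGb _, fun x y => ?_, ?_⟩
  · simp only [hG]
    have h1 := abs_sub_le_of_hasDerivAt hg hgb (c * x) (c * y)
    have h2 := hh.2 (c * x) (c * y)
    rw [← mul_sub, abs_mul, abs_of_pos hc0] at h1 h2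
    calc |g (c * x) - h (c * x) - (g (c * y) - h (c * y))|
        = |(g (c * x) - g (c * y)) - (h (c * x) - h (c * y))| := by ring_nf
      _ ≤ |g (c * x) - g (c * y)| + |h (c * x) - h (c * y)| := abs_sub _ _
      _ ≤ (c + 1 / b * c) * |x - y| := by linarith
      _ ≤ _ := by gcongr
  · have hlin : ∀ x, HasDerivAt (fun x => c * x) c x := fun x => by
      simpa using (hasDerivAt_id x).const_mul c
    have key := H.integral_comp_partialSum_card hQ (g := fun x => g (c * x))
      (g' := fun x => c * g' (c * x)) (G := fun x => c ^ 2 * G (c * x))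
      (C := 1) (C' := c * (1 / b)) (D := c ^ 2 * (2 / b ^ 2))
      (fun x => ((hg (c * x)).comp x (hlin x)).congr_deriv (by ring))
      (fun x => (((hg' (c * x)).comp x (hlin x)).const_mul c).congr_deriv (by ring))
      (by fun_prop) (fun x => hg1 _)
      (fun x => by rw [abs_mul, abs_of_pos hc0]; gcongr; exact hgb _)
      (fun x => by
        rw [abs_mul, abs_of_pos (by positivity)]
        gcongr
        rw [le_div_iff₀ (by positivity), mul_comm]
        simpa [abs_mul] using hGb (c * x))
    simp only [integral_const_mul, mul_zero, hg0] at key ⊢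
    have hm := H.measurable_card_sum
    have e : ∫ ω, h (c * partialSum Y (N ω) ω) ∂P =
        ∫ ω, g (c * partialSum Y (N ω) ω) ∂P - b ^ 2 * ∫ ω, G (c * partialSum Y (N ω) ω) ∂P := by
      rw [← integral_const_mul, ← integral_sub]
      · simp [hG]
      · exact Integrable.of_bound (cg.measurable.comp (hm.const_mul c)).aestronglyMeasurable 1
          (ae_of_all _ fun ω => hg1 _)
      · exact Integrable.of_bound
          ((cG.measurable.comp (hm.const_mul c)).const_mul (b ^ 2)).aestronglyMeasurable 2
          (ae_of_all _ fun ω => hGb _)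
    -- The scale b is chosen for this identity: the telescoping factor becomes the coefficient in
    -- the Stein equation.
    have hbs : s ^ 2 / 2 * c ^ 2 = b ^ 2 := by
      linear_combination (-(1 / 2) * c ^ 2) * hb2 + b ^ 2 * hcμ
    rw [e, key, ← mul_assoc, hbs]
    ring

end IsRandomSum

/-! ### The distance bounds, with and without coupled equilibrium variables -/

theorem ofReal_abs_integral_le_of_lipschitz {Ω : Type*} [MeasurableSpace Ω] {P : Measure Ω}
    {F : ℝ → ℝ} {L : ℝ} (hL : 0 ≤ L) (hF : ∀ x y, |F x - F y| ≤ L * |x - y|) (U V : Ω → ℝ) :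
    ENNReal.ofReal |∫ ω, (F (U ω) - F (V ω)) ∂P| ≤
      ENNReal.ofReal L * ∫⁻ ω, ENNReal.ofReal |U ω - V ω| ∂P := by
  rw [← Real.enorm_eq_ofReal_abs, ← lintegral_const_mul' _ _ ENNReal.ofReal_ne_top]
  refine (enorm_integral_le_lintegral_enorm _).trans (lintegral_mono fun ω => ?_)
  rw [Real.enorm_eq_ofReal_abs, ← ENNReal.ofReal_mul hL]
  exact ENNReal.ofReal_le_ofReal (hF _ _)

/-- With zero-based indices, `K + 1` corresponds to M, so the bracket is the quantity whose absolute
value appears in the bound. -/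
theorem partialSum_add_sub {Ω : Type*} {Y : ℕ → Ω → ℝ} {N K : Ω → ℕ} (ω : Ω) (y : ℝ) :
    partialSum Y (K ω) ω + y - partialSum Y (N ω) ω =
      -((Y (K ω) ω - y) + (partialSum Y (N ω) ω - partialSum Y (K ω + 1) ω)) := by
  simp only [partialSum, Finset.sum_range_succ]
  ring

theorem ofReal_abs_sub_add_le (a b c : ℝ) :
    ENNReal.ofReal |a - b + c| ≤ ENNReal.ofReal |a| + ENNReal.ofReal |b| + ENNReal.ofReal |c| := by
  rw [← ENNReal.ofReal_add (abs_nonneg _) (abs_nonneg _), ← ENNReal.ofReal_add (by positivity)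
    (abs_nonneg _)]
  exact ENNReal.ofReal_le_ofReal ((abs_add_le _ _).trans (by linarith [abs_sub a b]))

namespace IsRandomSum

variable {Ω : Type*} [MeasurableSpace Ω] {P : Measure Ω} [IsProbabilityMeasure P]
  {Y : ℕ → Ω → ℝ} {τ : ℕ → ℝ} {N K : Ω → ℕ} {s : ℝ}

omit [IsProbabilityMeasure P] in
theorem coeff_nonneg (H : IsRandomSum P Y τ N K s) {μ : ℝ} (hμ : 0 < μ) :
    0 ≤ μ ^ (-(1 / 2) : ℝ) + √8 / s := by
  have := H.pos
  positivity

/-- The bound for equilibrium variables coupled with the summands. -/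
theorem dBL_le_of_coupling (H : IsRandomSum P Y τ N K s) {μ : ℝ} (hμ : 0 < μ) {Z : ℕ → Ω → ℝ}
    (hZ : ∀ i, Measurable (Z i)) (hQ : ∀ i, IsSymmetricEquilibrium (P.map (Y i)) (P.map (Z i)))
    (hYZ : ∀ i, IndepFun (Z i) (partialSum Y i) P)
    (hK : IndepFun K (fun ω i => (Y i ω, Z i ω)) P) :
    dBL (P.map fun ω => μ ^ (-(1 / 2) : ℝ) * partialSum Y (N ω) ω)
        (laplaceMeasure 0 (s / √(2 * μ))) ≤
      ENNReal.ofReal (μ ^ (-(1 / 2) : ℝ) + √8 / s) * ∫⁻ ω, ENNReal.ofReal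
        |(Y (K ω) ω - Z (K ω) ω) + (partialSum Y (N ω) ω - partialSum Y (K ω + 1) ω)| ∂P := by
  refine dBL_map_le (H.measurable_card_sum.const_mul _) fun h hh => ?_
  obtain ⟨F, hFc, hFb, hFl, hF⟩ := H.exists_stein_representation hQ hμ hh
  have hYZm : Measurable fun ω i => (Y i ω, Z i ω) :=
    measurable_pi_lambda _ fun i => (H.measurable i).prodMk (hZ i)
  -- Independence of each equilibrium variable from the preceding partial sum turns the double
  -- integral into an expectation on the original space.
  have h1 : ∀ m, ∫ ω, ∫ y, F (partialSum Y m ω + y) ∂(P.map (Z m)) ∂P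
      = ∫ ω, F (partialSum Y m ω + Z m ω) ∂P := fun m => by
    rw [(hYZ m).symm.integral_pair (H.measurable_partialSum m) (hZ m)
      (f := fun p => F (p.1 + p.2)) (by fun_prop) fun p => hFb _]
    refine integral_congr_ae (ae_of_all _ fun ω => ?_)
    exact integral_map (hZ m).aemeasurable (by fun_prop)
  have hm : ∀ m, Measurable fun z : ℕ → ℝ × ℝ =>
      ∑ i ∈ Finset.range m, (z i).1 + (z m).2 := fun m => by fun_prop
  -- Independence of K from the sequence of pairs then allows m to be replaced by K at the same
  -- sample point.
  have h2 := hK.integral_pair H.measurable_index hYZm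
    (f := fun p => F (∑ i ∈ Finset.range p.1, (p.2 i).1 + (p.2 p.1).2))
    (measurable_from_prod_countable_right fun m => hFc.measurable.comp (hm m)) fun p => hFb _
  have hmW : Measurable fun ω => partialSum Y (K ω) ω + Z (K ω) ω :=
    measurable_comp_index H.measurable_index hYZm hm
  have h3 : ∫ ω, ∫ ω', F (partialSum Y (K ω) ω' + Z (K ω) ω') ∂P ∂P
      = ∫ ω, F (partialSum Y (K ω) ω + Z (K ω) ω) ∂P := h2.symm
  rw [hF]
  simp only [h1]
  rw [h3, ← integral_sub]
  · refine (ofReal_abs_integral_le_of_lipschitz (H.coeff_nonneg hμ) hFl _ _).trans_eq ?_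
    simp only [partialSum_add_sub, abs_neg]
  · exact Integrable.of_bound (hFc.measurable.comp hmW).aestronglyMeasurable 2
      (ae_of_all _ fun ω => hFb _)
  · exact Integrable.of_bound (hFc.measurable.comp H.measurable_card_sum).aestronglyMeasurable 2
      (ae_of_all _ fun ω => hFb _)

/-- The bound for equilibrium variables independent of everything else. -/
theorem dBL_le_lintegral (H : IsRandomSum P Y τ N K s) {μ : ℝ} (hμ : 0 < μ) {Q : ℕ → Measure ℝ}
    (hQ : ∀ i, IsSymmetricEquilibrium (P.map (Y i)) (Q i)) :
    dBL (P.map fun ω => μ ^ (-(1 / 2) : ℝ) * partialSum Y (N ω) ω)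
        (laplaceMeasure 0 (s / √(2 * μ))) ≤
      ENNReal.ofReal (μ ^ (-(1 / 2) : ℝ) + √8 / s) * ∫⁻ ω, ∫⁻ y, ENNReal.ofReal
        |(Y (K ω) ω - y) + (partialSum Y (N ω) ω - partialSum Y (K ω + 1) ω)| ∂(Q (K ω)) ∂P := by
  refine dBL_map_le (H.measurable_card_sum.const_mul _) fun h hh => ?_
  have hQp := fun i => (hQ i).isProbabilityMeasure
  obtain ⟨F, hFc, hFb, hFl, hF⟩ := H.exists_stein_representation hQ hμ hh
  have hk : ∀ m, Measurable fun z : ℕ → ℝ => ∫ y, F (∑ i ∈ Finset.range m, z i + y) ∂(Q m) :=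
    fun m => (measurable_integral_add hFc.measurable).comp (measurable_partialSum_pi m)
  have h2 := H.indep_index.integral_pair H.measurable_index H.measurable_pi
    (f := fun p => ∫ y, F (∑ i ∈ Finset.range p.1, p.2 i + y) ∂(Q p.1))
    (measurable_from_prod_countable_right hk) fun p => abs_integral_le_of_abs_le fun y => hFb _
  have h3 : ∫ ω, ∫ ω', ∫ y, F (partialSum Y (K ω) ω' + y) ∂(Q (K ω)) ∂P ∂P
      = ∫ ω, ∫ y, F (partialSum Y (K ω) ω + y) ∂(Q (K ω)) ∂P := h2.symm
  have hmK : Measurable fun ω => ∫ y, F (partialSum Y (K ω) ω + y) ∂(Q (K ω)) :=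
    measurable_comp_index H.measurable_index H.measurable_pi hk
  rw [hF, h3, ← integral_sub]
  · rw [← Real.enorm_eq_ofReal_abs, ← lintegral_const_mul' _ _ ENNReal.ofReal_ne_top]
    refine (enorm_integral_le_lintegral_enorm _).trans (lintegral_mono fun ω => ?_)
    have hi : Integrable (fun y => F (partialSum Y (K ω) ω + y)) (Q (K ω)) :=
      Integrable.of_bound (by fun_prop) 2 (ae_of_all _ fun ω => hFb _)
    have e : (∫ y, F (partialSum Y (K ω) ω + y) ∂(Q (K ω))) - F (partialSum Y (N ω) ω)
        = ∫ y, (F (partialSum Y (K ω) ω + y) - F (partialSum Y (N ω) ω)) ∂(Q (K ω)) := by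
      rw [integral_sub hi (integrable_const _)]
      simp
    rw [e, Real.enorm_eq_ofReal_abs]
    refine (ofReal_abs_integral_le_of_lipschitz (H.coeff_nonneg hμ) hFl _ _).trans_eq ?_
    simp only [partialSum_add_sub, abs_neg]
  · exact Integrable.of_bound hmK.aestronglyMeasurable 2
      (ae_of_all _ fun ω => abs_integral_le_of_abs_le fun y => hFb _)
  · exact Integrable.of_bound (hFc.measurable.comp H.measurable_card_sum).aestronglyMeasurable 2
      (ae_of_all _ fun ω => hFb _)

theorem lintegral_lintegral_le (H : IsRandomSum P Y τ N K s) (hτ : ∀ i, 0 < τ i)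
    {Q : ℕ → Measure ℝ} (hQ : ∀ i, IsSymmetricEquilibrium (P.map (Y i)) (Q i)) :
    ∫⁻ ω, ∫⁻ y, ENNReal.ofReal |(Y (K ω) ω - y) +
        (partialSum Y (N ω) ω - partialSum Y (K ω + 1) ω)| ∂(Q (K ω)) ∂P ≤
      ∫⁻ ω, ENNReal.ofReal |Y (K ω) ω| ∂P
        + 1 / 3 * ∫⁻ ω, ENNReal.ofReal (|Y (K ω) ω| ^ 3 / τ (K ω) ^ 2) ∂P
        + (⨆ i, ENNReal.ofReal (τ i)) *
          ∫⁻ ω, ENNReal.ofReal (|(N ω : ℝ) - (K ω + 1 : ℕ)| ^ (1 / 2 : ℝ)) ∂P := by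
  have hQp := fun i => (hQ i).isProbabilityMeasure
  rw [← H.lintegral_abs_equilibrium hτ hQ]
  have h1 := H.measurable_index_apply.abs.ennreal_ofReal
  have h4 : Measurable fun ω => ∫⁻ y, ENNReal.ofReal |y| ∂(Q (K ω)) :=
    (measurable_of_countable fun k => ∫⁻ y, ENNReal.ofReal |y| ∂(Q k)).comp H.measurable_index
  refine le_trans ?_ (add_le_add le_rfl H.lintegral_abs_partialSum_sub_le)
  have h5 : Measurable fun ω =>
      ENNReal.ofReal |Y (K ω) ω| + ∫⁻ y, ENNReal.ofReal |y| ∂(Q (K ω)) := h1.add h4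
  rw [← lintegral_add_left h1, ← lintegral_add_left h5]
  refine lintegral_mono fun ω => ?_
  calc _ ≤ ∫⁻ y, (ENNReal.ofReal |Y (K ω) ω| + ENNReal.ofReal |y| + ENNReal.ofReal
          |partialSum Y (N ω) ω - partialSum Y (K ω + 1) ω|) ∂(Q (K ω)) :=
        lintegral_mono fun y => ofReal_abs_sub_add_le _ _ _
    _ = _ := by
      rw [lintegral_add_left (by fun_prop), lintegral_add_left (by fun_prop)]
      simp

theorem lintegral_coupling_le (H : IsRandomSum P Y τ N K s) (hτ : ∀ i, 0 < τ i)
    {Z : ℕ → Ω → ℝ} (hZ : ∀ i, Measurable (Z i))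
    (hQ : ∀ i, IsSymmetricEquilibrium (P.map (Y i)) (P.map (Z i)))
    (hK : IndepFun K (fun ω i => (Y i ω, Z i ω)) P) :
    ∫⁻ ω, ENNReal.ofReal
        |(Y (K ω) ω - Z (K ω) ω) + (partialSum Y (N ω) ω - partialSum Y (K ω + 1) ω)| ∂P ≤
      ∫⁻ ω, ENNReal.ofReal |Y (K ω) ω| ∂P
        + 1 / 3 * ∫⁻ ω, ENNReal.ofReal (|Y (K ω) ω| ^ 3 / τ (K ω) ^ 2) ∂P
        + (⨆ i, ENNReal.ofReal (τ i)) *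
          ∫⁻ ω, ENNReal.ofReal (|(N ω : ℝ) - (K ω + 1 : ℕ)| ^ (1 / 2 : ℝ)) ∂P := by
  rw [← H.lintegral_abs_equilibrium hτ hQ]
  have hZm : Measurable fun ω i => Z i ω := measurable_pi_lambda _ hZ
  have hKZ : IndepFun K (fun ω i => Z i ω) P :=
    hK.comp (ψ := fun (z : ℕ → ℝ × ℝ) i => (z i).2) measurable_id (by fun_prop)
  have h0 : ∫⁻ ω, ENNReal.ofReal |Z (K ω) ω| ∂P =
      ∫⁻ ω, ∫⁻ y, ENNReal.ofReal |y| ∂(P.map (Z (K ω))) ∂P := by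
    rw [hKZ.lintegral_pair H.measurable_index hZm (f := fun p => ENNReal.ofReal |p.2 p.1|)
      (measurable_from_prod_countable_right fun n => by simp only; fun_prop)]
    refine lintegral_congr fun ω => ?_
    rw [lintegral_map (by fun_prop) (hZ _)]
  have h1 := H.measurable_index_apply.abs.ennreal_ofReal
  have h4 : Measurable fun ω => Z (K ω) ω :=
    measurable_comp_index (F := fun m (z : ℕ → ℝ) => z m) H.measurable_index hZm
      measurable_pi_apply
  refine le_trans ?_ (add_le_add le_rfl H.lintegral_abs_partialSum_sub_le)
  have h5 : Measurable fun ω => ENNReal.ofReal |Y (K ω) ω| + ENNReal.ofReal |Z (K ω) ω| :=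
    h1.add h4.abs.ennreal_ofReal
  rw [← h0, ← lintegral_add_left h1, ← lintegral_add_left h5]
  exact lintegral_mono fun ω => ofReal_abs_sub_add_le _ _ _

end IsRandomSum

/-! ### Passage from one-based to zero-based indices, and the theorem -/

theorem sum_Icc_one_eq_sum_range (f : ℕ → ℝ) (n : ℕ) :
    ∑ i ∈ Finset.Icc 1 n, f i = ∑ i ∈ Finset.range n, f (i + 1) := by
  rw [Finset.range_eq_Ico, Finset.sum_Ico_add' f 0 n 1]
  rfl

theorem sum_Icc_one_eq_partialSum {Ω : Type*} (X : ℕ → Ω → ℝ) (n : ℕ) (ω : Ω) :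
    ∑ i ∈ Finset.Icc 1 n, X i ω = partialSum (fun i => X (i + 1)) n ω :=
  sum_Icc_one_eq_sum_range (fun i => X i ω) n

theorem sign_mul_sum_Ioc {n m : ℕ} (f : ℕ → ℝ) :
    Real.sign ((n : ℝ) - m) * ∑ i ∈ Finset.Ioc (min n m) (max n m), f i =
      ∑ i ∈ Finset.range n, f (i + 1) - ∑ i ∈ Finset.range m, f (i + 1) := by
  have e : ∀ a b, ∑ i ∈ Finset.Ioc a b, f i = ∑ i ∈ Finset.Ico a b, f (i + 1) := fun a b => by
    rw [Finset.sum_Ico_add' f a b 1]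
    congr 1
    ext i
    simp only [Finset.mem_Ioc, Finset.mem_Ico]
    omega
  rw [e]
  rcases lt_trichotomy n m with h | rfl | h
  · rw [Real.sign_of_neg (by simpa using h), min_eq_left h.le, max_eq_right h.le,
      Finset.sum_Ico_eq_sub _ h.le]
    ring
  · simp
  · rw [Real.sign_of_pos (by simpa using h), min_eq_right h.le, max_eq_left h.le,
      Finset.sum_Ico_eq_sub _ h.le]
    ring

/-- An index of positive integers whose law is proportional to the weights `σ m ^ 2 * P(N ≥ m)`
does not vanish. -/
theorem ae_one_le_of_weights {Ω : Type*} [MeasurableSpace Ω] {P : Measure Ω}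
    [IsProbabilityMeasure P] {τ : ℕ → ℝ} {N M : Ω → ℕ} {s : ℝ} (hN : Measurable N)
    (hM : Measurable M) (hs : 0 < s)
    (hint : Integrable (fun ω => ∑ i ∈ Finset.range (N ω), τ i ^ 2) P)
    (hsq : s ^ 2 = ∫ ω, ∑ i ∈ Finset.range (N ω), τ i ^ 2 ∂P)
    (h : ∀ m, P.real {ω | M ω = m + 1} = τ m ^ 2 / s ^ 2 * P.real {ω | m < N ω}) :
    ∀ᵐ ω ∂P, 1 ≤ M ω := by
  have h1 := hasSum_weights hN hint (d := fun _ => 1) (C := 1) (by simp)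
  have h2 := hasSum_integral_comp_nat (P := P) hM (d := fun _ => 1) (C := 1) (by simp)
  simp only [mul_one, ← hsq] at h1 h2
  -- The weights total s², so the values m ≥ 1 already carry mass one and nothing is left for zero.
  have h3 : HasSum (fun m => P.real {ω | M ω = m + 1}) 1 := by
    have := h1.div_const (s ^ 2)
    rw [div_self (by positivity)] at this
    refine this.congr_fun fun m => ?_
    rw [h]
    ring
  have h4 := (hasSum_nat_add_iff' (f := fun m => P.real {ω | M ω = m}) 1).2 h2
  have h5 := h3.unique h4
  have h6 : P {ω | M ω = 0} = 0 := by
    rw [← measureReal_eq_zero_iff]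
    simp only [integral_const, probReal_univ, smul_eq_mul, mul_one, Finset.sum_range_one] at h5
    linarith
  refine measure_mono_null (fun ω hω => ?_) h6
  simp only [Set.mem_compl_iff, Set.mem_ofPred_eq, not_le] at hω ⊢
  omega

theorem theorem6 {Ω : Type*} [MeasurableSpace Ω] (P : Measure Ω) [IsProbabilityMeasure P]
    -- the summands `X 1, X 2, …` (the value `X 0` plays no role)
    (X : ℕ → Ω → ℝ) (σ : ℕ → ℝ)
    (hXmeas : ∀ i, 1 ≤ i → Measurable (X i))
    (hXindep : iIndepFun (fun i : ℕ => X (i + 1)) P)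
    (hXneg : ∀ i, 1 ≤ i → P.real {ω | X i ω < 0} = 1 / 2)
    (hXpos : ∀ i, 1 ≤ i → P.real {ω | 0 < X i ω} = 1 / 2)
    (hXL2 : ∀ i, 1 ≤ i → MemLp (X i) 2 P)
    (hXmean : ∀ i, 1 ≤ i → ∫ ω, X i ω ∂P = 0)
    (hσ_nonneg : ∀ i, 1 ≤ i → 0 ≤ σ i)
    (hσ : ∀ i, 1 ≤ i → ∫ ω, (X i ω) ^ 2 ∂P = (σ i) ^ 2)
    -- the random index `N`, not almost surely zero, with finite mean `μ`
    (N M : Ω → ℕ) (hNmeas : Measurable N) (hMmeas : Measurable M)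
    (μ : ℝ) (hNint : Integrable (fun ω => (N ω : ℝ)) P)
    (hμ : μ = ∫ ω, (N ω : ℝ) ∂P) (hμ_pos : 0 < μ)
    -- `s ^ 2 = E[∑_{i ≤ N} σ_i ^ 2] < ∞`
    (s : ℝ) (hs_nonneg : 0 ≤ s)
    (hs_int : Integrable (fun ω => ∑ i ∈ Finset.Icc 1 (N ω), (σ i) ^ 2) P)
    (hs : s ^ 2 = ∫ ω, ∑ i ∈ Finset.Icc 1 (N ω), (σ i) ^ 2 ∂P)
    -- the law of `M`; the coupling of `M` with `N` is arbitrary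
    (hM : ∀ m, 1 ≤ m →
      P.real {ω | M ω = m} = (σ m) ^ 2 / s ^ 2 * P.real {ω | m ≤ N ω})
    (hNMindep : IndepFun (fun ω => (N ω, M ω)) (fun ω (i : ℕ) => X (i + 1) ω) P) :
    -- `s ^ 2` is also the second moment of the random sum
    (Integrable (fun ω => (∑ i ∈ Finset.Icc 1 (N ω), X i ω) ^ 2) P ∧
      ∫ ω, (∑ i ∈ Finset.Icc 1 (N ω), X i ω) ^ 2 ∂P = s ^ 2) ∧
    -- each `X i` has a symmetric equilibrium distribution
    (∀ i, 1 ≤ i → ∃ ρL : Measure ℝ, IsSymmetricEquilibrium (P.map (X i)) ρL) ∧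
    -- the two bounds, for every choice of the variables `XL i`
    (∀ XL : ℕ → Ω → ℝ,
      (∀ i, 1 ≤ i → Measurable (XL i)) →
      (∀ i, 1 ≤ i → IsSymmetricEquilibrium (P.map (X i)) (P.map (XL i))) →
      (∀ m, 1 ≤ m →
        IndepFun (XL m) (fun ω (i : Finset.Ico 1 m) => X (i : ℕ) ω) P) →
      IndepFun (fun ω => (N ω, M ω)) (fun ω (i : ℕ) => (X (i + 1) ω, XL (i + 1) ω)) P →
      dBL (P.map fun ω => μ ^ (-(1 / 2) : ℝ) * ∑ i ∈ Finset.Icc 1 (N ω), X i ω)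
          (laplaceMeasure 0 (s / √(2 * μ)))
        ≤ ENNReal.ofReal (μ ^ (-(1 / 2) : ℝ) + √8 / s) *
          ∫⁻ ω, ENNReal.ofReal
            |(X (M ω) ω - XL (M ω) ω) + Real.sign ((N ω : ℝ) - (M ω : ℝ)) *
              ∑ i ∈ Finset.Ioc (min (N ω) (M ω)) (max (N ω) (M ω)), X i ω| ∂P ∧
      ENNReal.ofReal (μ ^ (-(1 / 2) : ℝ) + √8 / s) *
          ∫⁻ ω, ENNReal.ofReal
            |(X (M ω) ω - XL (M ω) ω) + Real.sign ((N ω : ℝ) - (M ω : ℝ)) *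
              ∑ i ∈ Finset.Ioc (min (N ω) (M ω)) (max (N ω) (M ω)), X i ω| ∂P
        ≤ ENNReal.ofReal (μ ^ (-(1 / 2) : ℝ) + √8 / s) *
          ((∫⁻ ω, ENNReal.ofReal |X (M ω) ω| ∂P)
            + 1 / 3 * (∫⁻ ω, ENNReal.ofReal (|X (M ω) ω| ^ 3 / (σ (M ω)) ^ 2) ∂P)
            + (⨆ i ∈ Set.Ici (1 : ℕ), ENNReal.ofReal (σ i)) *
              ∫⁻ ω, ENNReal.ofReal (|(N ω : ℝ) - (M ω : ℝ)| ^ (1 / 2 : ℝ)) ∂P)) ∧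
    -- the resulting bound, which does not involve the variables `XL i`
    dBL (P.map fun ω => μ ^ (-(1 / 2) : ℝ) * ∑ i ∈ Finset.Icc 1 (N ω), X i ω)
        (laplaceMeasure 0 (s / √(2 * μ)))
      ≤ ENNReal.ofReal (μ ^ (-(1 / 2) : ℝ) + √8 / s) *
        ((∫⁻ ω, ENNReal.ofReal |X (M ω) ω| ∂P)
          + 1 / 3 * (∫⁻ ω, ENNReal.ofReal (|X (M ω) ω| ^ 3 / (σ (M ω)) ^ 2) ∂P)
          + (⨆ i ∈ Set.Ici (1 : ℕ), ENNReal.ofReal (σ i)) *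
            ∫⁻ ω, ENNReal.ofReal (|(N ω : ℝ) - (M ω : ℝ)| ^ (1 / 2 : ℝ)) ∂P) := by
  have hXmeas' : ∀ i, Measurable (X (i + 1)) := fun i => hXmeas _ (by omega)
  have hI : IsCenteredIndep P (fun i => X (i + 1)) (fun i => σ (i + 1)) :=
    ⟨hXmeas', hXindep, fun i => hXL2 _ (by omega), fun i => hXmean _ (by omega),
      fun i => hσ_nonneg _ (by omega), fun i => hσ _ (by omega)⟩
  -- If the variance vanished, the summand would be zero almost surely, contradicting that it is
  -- positive with probability 1/2.
  have hσ_pos : ∀ i, 0 < σ (i + 1) := fun i => by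
    refine (hσ_nonneg _ (by omega)).lt_of_ne fun h0 => ?_
    have h1 := hσ (i + 1) (by omega)
    rw [← h0, zero_pow two_ne_zero, integral_eq_zero_iff_of_nonneg (fun ω => sq_nonneg _)
      (hXL2 _ (by omega)).integrable_sq] at h1
    have h2 : P {ω | 0 < X (i + 1) ω} = 0 := by
      refine measure_mono_null (fun ω hω => ?_) h1
      simp only [Set.mem_compl_iff, Set.mem_ofPred_eq] at hω ⊢
      exact (pow_pos hω 2).ne'
    have h3 := hXpos (i + 1) (by omega)
    rw [measureReal_def, h2] at h3
    norm_num at h3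
  have eσ : ∀ n, ∑ i ∈ Finset.Icc 1 n, σ i ^ 2 = ∑ i ∈ Finset.range n, σ (i + 1) ^ 2 :=
    sum_Icc_one_eq_sum_range fun i => σ i ^ 2
  simp only [eσ] at hs_int hs
  -- If s = 0, positivity of the first variance forces N = 0 almost surely, contradicting μ > 0.
  have hs_pos : 0 < s := by
    refine hs_nonneg.lt_of_ne fun h0 => hμ_pos.ne' ?_
    rw [← h0, zero_pow two_ne_zero, eq_comm, integral_eq_zero_iff_of_nonneg
      (fun ω => Finset.sum_nonneg fun i _ => sq_nonneg _) hs_int] at hs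
    rw [hμ]
    refine integral_eq_zero_of_ae (hs.mono fun ω hω => ?_)
    have h1 := (Finset.sum_eq_zero_iff_of_nonneg fun i _ => sq_nonneg _).1 hω
    have h2 : N ω = 0 := by
      by_contra hne
      exact (pow_pos (hσ_pos 0) 2).ne' (h1 0 (Finset.mem_range.2 (Nat.pos_of_ne_zero hne)))
    simp [h2]
  have hM' : ∀ m, P.real {ω | M ω = m + 1} =
      σ (m + 1) ^ 2 / s ^ 2 * P.real {ω | m < N ω} := fun m => hM (m + 1) (by omega)
  have hM1 : ∀ᵐ ω ∂P, 1 ≤ M ω :=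
    ae_one_le_of_weights (τ := fun i => σ (i + 1)) hNmeas hMmeas hs_pos hs_int hs hM'
  have hpred : Measurable fun n : ℕ => n - 1 := measurable_of_countable _
  -- The zero-based index is K = M - 1. Truncated subtraction is harmless because M ≥ 1 almost
  -- surely; for the same reason replacing M by `M ω - 1 + 1` below leaves the integrals unchanged.
  have hR : IsRandomSum P (fun i => X (i + 1)) (fun i => σ (i + 1)) N (fun ω => M ω - 1) s := by
    refine ⟨hI, hNmeas, hpred.comp hMmeas, ?_, hs_int, hs_pos, hs, fun m => ?_⟩
    · exact hNMindep.comp (φ := fun p : ℕ × ℕ => (p.1, p.2 - 1))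
        (measurable_fst.prodMk (hpred.comp measurable_snd)) measurable_id
    · rw [← hM' m]
      refine measureReal_congr ?_
      filter_upwards [hM1] with ω hω
      refine propext (show M ω - 1 = m ↔ M ω = m + 1 by omega)
  have hex : ∀ i, IsSymmetricEquilibrium (P.map (X (i + 1)))
      (symmetricEquilibrium (P.map (X (i + 1)))) := fun i => by
    have hm := (hXmeas' i).aemeasurable (μ := P)
    have := Measure.isProbabilityMeasure_map hm
    refine isSymmetricEquilibrium_symmetricEquilibrium ?_ ?_ ?_
    · exact (integrable_map_measure (by fun_prop) hm).2 (hI.memLp i).integrable_sq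
    · rw [integral_map hm (by fun_prop), hI.sq]
      exact pow_pos (hσ_pos i) 2
    · rw [integral_map hm (by fun_prop), hI.mean]
  have eS : (fun ω => μ ^ (-(1 / 2) : ℝ) * ∑ i ∈ Finset.Icc 1 (N ω), X i ω) =
      fun ω => μ ^ (-(1 / 2) : ℝ) * partialSum (fun i => X (i + 1)) (N ω) ω :=
    funext fun ω => by rw [sum_Icc_one_eq_partialSum]
  have eB : (∫⁻ ω, ENNReal.ofReal |X (M ω) ω| ∂P)
      + 1 / 3 * (∫⁻ ω, ENNReal.ofReal (|X (M ω) ω| ^ 3 / (σ (M ω)) ^ 2) ∂P)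
      + (⨆ i ∈ Set.Ici (1 : ℕ), ENNReal.ofReal (σ i)) *
        ∫⁻ ω, ENNReal.ofReal (|(N ω : ℝ) - (M ω : ℝ)| ^ (1 / 2 : ℝ)) ∂P =
      (∫⁻ ω, ENNReal.ofReal |X (M ω - 1 + 1) ω| ∂P)
      + 1 / 3 * (∫⁻ ω, ENNReal.ofReal (|X (M ω - 1 + 1) ω| ^ 3 / (σ (M ω - 1 + 1)) ^ 2) ∂P)
      + (⨆ i, ENNReal.ofReal (σ (i + 1))) *
        ∫⁻ ω, ENNReal.ofReal (|(N ω : ℝ) - (M ω - 1 + 1 : ℕ)| ^ (1 / 2 : ℝ)) ∂P := by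
    have hsup : ⨆ i ∈ Set.Ici (1 : ℕ), ENNReal.ofReal (σ i) = ⨆ i, ENNReal.ofReal (σ (i + 1)) := by
      refine le_antisymm (iSup₂_le fun i hi => ?_)
        (iSup_le fun i => le_iSup₂_of_le (i + 1) (Set.mem_Ici.2 (by omega)) le_rfl)
      obtain ⟨j, rfl⟩ : ∃ j, i = j + 1 := ⟨i - 1, (Nat.sub_add_cancel hi).symm⟩
      exact le_iSup (fun i => ENNReal.ofReal (σ (i + 1))) j
    rw [hsup]
    congr 1
    · congr 1
      · refine lintegral_congr_ae (hM1.mono fun ω hω => ?_)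
        simp only [Nat.sub_add_cancel hω]
      · congr 1
        refine lintegral_congr_ae (hM1.mono fun ω hω => ?_)
        simp only [Nat.sub_add_cancel hω]
    · congr 1
      refine lintegral_congr_ae (hM1.mono fun ω hω => ?_)
      simp only [Nat.sub_add_cancel hω]
  refine ⟨?_, fun i hi => ?_, fun XL hXLm hXL hXLindep hNMXL => ?_, ?_⟩
  · have h := hR.lintegral_sq_partialSum
    have hm := (hR.measurable_card_sum.pow_const 2).aestronglyMeasurable (μ := P)
    have h0 : 0 ≤ᵐ[P] fun ω => partialSum (fun i => X (i + 1)) (N ω) ω ^ 2 :=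
      ae_of_all _ fun ω => sq_nonneg _
    simp only [sum_Icc_one_eq_partialSum]
    refine ⟨(lintegral_ofReal_ne_top_iff_integrable hm h0).1 (h ▸ ENNReal.ofReal_ne_top), ?_⟩
    rw [integral_eq_lintegral_of_nonneg_ae h0 hm, h, ENNReal.toReal_ofReal (sq_nonneg _)]
  · obtain ⟨j, rfl⟩ : ∃ j, i = j + 1 := ⟨i - 1, (Nat.sub_add_cancel hi).symm⟩
    exact ⟨_, hex j⟩
  · have hZm : ∀ i, Measurable (XL (i + 1)) := fun i => hXLm _ (by omega)
    have hQ : ∀ i, IsSymmetricEquilibrium (P.map (X (i + 1))) (P.map (XL (i + 1))) :=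
      fun i => hXL _ (by omega)
    have hK : IndepFun (fun ω => M ω - 1) (fun ω i => (X (i + 1) ω, XL (i + 1) ω)) P :=
      hNMXL.comp (φ := fun p : ℕ × ℕ => p.2 - 1) (hpred.comp measurable_snd) measurable_id
    -- The first i summands in zero-based order are X_1, …, X_i, precisely those of which X_(i+1)^L
    -- is assumed independent.
    have hYZ : ∀ i, IndepFun (XL (i + 1)) (partialSum (fun i => X (i + 1)) i) P := fun i => by
      have h := (hXLindep (i + 1) (by omega)).comp measurable_id
        (ψ := fun z : Finset.Ico 1 (i + 1) → ℝ => ∑ j, z j) (by fun_prop)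
      convert! h using 1
      funext ω
      rw [← sum_Icc_one_eq_partialSum]
      exact (Finset.sum_coe_sort (Finset.Ico 1 (i + 1)) fun j => X j ω).symm
    have eE : ∫⁻ ω, ENNReal.ofReal
          |(X (M ω) ω - XL (M ω) ω) + Real.sign ((N ω : ℝ) - (M ω : ℝ)) *
            ∑ i ∈ Finset.Ioc (min (N ω) (M ω)) (max (N ω) (M ω)), X i ω| ∂P =
        ∫⁻ ω, ENNReal.ofReal |(X (M ω - 1 + 1) ω - XL (M ω - 1 + 1) ω) +
          (partialSum (fun i => X (i + 1)) (N ω) ω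
            - partialSum (fun i => X (i + 1)) (M ω - 1 + 1) ω)| ∂P := by
      refine lintegral_congr_ae (hM1.mono fun ω hω => ?_)
      simp only [Nat.sub_add_cancel hω, partialSum, sign_mul_sum_Ioc fun i => X i ω]
    rw [eE, eB, eS]
    exact ⟨hR.dBL_le_of_coupling hμ_pos hZm hQ hYZ hK,
      mul_le_mul_right (hR.lintegral_coupling_le hσ_pos hZm hQ hK) _⟩
  -- Here the explicit equilibrium laws serve as Q, so no equilibrium variables on Ω are needed.
  · rw [eB, eS]
    exact (hR.dBL_le_lintegral hμ_pos hex).trans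
      (mul_le_mul_right (hR.lintegral_lintegral_le hσ_pos hex) _)
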